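/- Let $\mathcal X\subseteq\mathbb R^n$ be open, let $f:\mathcal X\to\mathbb R^n$ and $g:\mathcal X\to\mathbb R^{n\times m}$ be locally Lipschitz with $\operatorname{rank} g(x)=m$ for all $x\in\mathcal X$, and consider the system $\dot x=f(x)+g(x)u$. For vector-valued $F$ let $\nabla F$ be the matrix with entries $(\nabla F)_{ij}=\partial F_j/\partial x_i$, and let a subscript $*$ denote evaluation at $x_*$. Assume the following. 1. There are a $C^2$ function $S:\mathcal X\to\mathbb R$ and a map $\ell:\mathcal X\to\mathbb R^r$ with $[\nabla S(x)]^\top f(x)=-\|\ell(x)\|^2$ on $\mathcal X$. With given maps $w:\mathcal X\to\mathbb R^{r\times m}$ and $D:\mathcal X\to\mathbb R^{m\times m}$, $D=-D^\top$, put $$y=g^\top(x)\nabla S(x)+2w^\top(x)\ell(x)+[w^\top(x)w(x)+D(x)]u .$$ 2. The point $x_*\in\mathcal X$ is an assignable equilibrium, i.e. $g^\perp(x_*)f(x_*)=0$ for a full-rank left annihilator $g^\perp(x_*)\in\mathbb R^{(n-m)\times n}$ of $g(x_*)$. With $\kappa=(g_*^\top g_*)^{-1}g_*^\top f_*$, there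 are a $C^2$ map $\gamma:\mathcal X\to\mathbb R^m$ and constants $\alpha_i,\beta_i>0$ such that $\dot\gamma=[\nabla\gamma(x)]^\top(f(x)+g(x)u)=y$ for all $x\in\mathcal X$, $u\in\mathbb R^m$, and $$(\nabla S)_*+(\nabla\gamma)_*\kappa=0,\qquad (\nabla^2S)_*+\sum_{i=1}^m\alpha_i\beta_i(\nabla\gamma_i)_*(\nabla\gamma_i)_*^\top+(\nabla^2(\gamma^\top\kappa))_*>0 .$$ Put $\alpha_c=\alpha$, $\beta_c=\beta$, $z_c=\gamma(x)-\gamma_*+x_c$ and $\Phi_c(z)=\sum_{i=1}^m\frac{\alpha_{c_i}}{\beta_{c_i}}\ln\cosh(\beta_{c_i}z_i)$. For symmetric positive definite $R_c,K_c\in\mathbb R^{m\times m}$ consider the dynamic controller, which uses only $\gamma(x)$ and its own state $x_c\in\mathbb R^m$ (and not the passive output $y$), $$\dot x_c=-R_c\Big[\sum_{i=1}^m e_i\alpha_{c_i}\tanh(\beta_{c_i}z_{c_i})+K_cx_c\Big],\qquad u=-\kappa-\sum_{i=1}^m e_i\alpha_{c_i}\tanh(\beta_{c_i}z_{c_i}).$$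 Then: (i) $u_i\in[-\kappa_i-\alpha_{c_i},-\kappa_i+\alpha_{c_i}]$ for every $i$, at every $(x,x_c)\in\mathcal X\times\mathbb R^m$. Moreover there is a positive definite $K_0\in\mathbb R^{m\times m}$ such that for all symmetric $K_c\ge K_0$ and all positive definite $R_c$: (ii) $(x_*,0)$ is a locally stable equilibrium of the closed-loop system on $\mathcal X\times\mathbb R^m$, with Lyapunov function $$S_{d_c}(x,x_c)=S(x)+\Phi_c(z_c)+\kappa^\top\gamma(x)+\tfrac12 x_c^\top K_cx_c,$$ that is, near $(x_*,0)$ the function $S_{d_c}$ is $C^1$, has a strict minimum at $(x_*,0)$, and its derivative along the closed loop is $\le 0$; (iii) the equilibrium is locally asymptotically stable if, for some open set $\Omega_c\subseteq\mathcal X\times\mathbb R^m$ containing $(x_*,0)$, the only closed-loop solution that stays in $\Omega_c$ for all $t\ge0$ and along which $$\ell=w(\kappa-K_cx_c)\quad\text{and}\quad y=0$$ hold identically is the constant solution $(x_*,0)$; in particular, it is locally asymptotically stable if these two equations at a point $(x,x_c)\in\Omega_c$ imply $x=x_*$ and $x_c=0$. Here $y$ is evaluated at the input $u$ given by the controller.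 -/

import Mathlib

open Matrix Filter Topology Set

/-! ### Calculus on `ℝⁿ`

Vectors of `ℝⁿ` are functions `Fin n → ℝ`.  Differentiability, local Lipschitz continuity and
Lyapunov stability do not depend on the choice of the norm of a finite-dimensional space; where the
Euclidean norm itself enters, it is written through the dot product, `‖v‖² = v ⬝ᵥ v`. -/

/-- The gradient `∇ h (x)`, the vector of the partial derivatives of `h`. -/
noncomputable def grad {n : ℕ} (h : (Fin n → ℝ) → ℝ) (x : Fin n → ℝ) : Fin n → ℝ :=
  fun i => fderiv ℝ h x (Pi.single i 1)

/-- The `n × m` Jacobian `(∇ F)ᵢⱼ = ∂ Fⱼ / ∂ xᵢ`; its columns are the gradients `∇ Fⱼ`. -/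
noncomputable def jac {n m : ℕ} (F : (Fin n → ℝ) → Fin m → ℝ) (x : Fin n → ℝ) :
    Matrix (Fin n) (Fin m) ℝ :=
  Matrix.of fun i j => grad (fun z => F z j) x i

/-- The Hessian `(∇² h)ᵢⱼ = ∂² h / ∂ xᵢ ∂ xⱼ`. -/
noncomputable def hess {n : ℕ} (h : (Fin n → ℝ) → ℝ) (x : Fin n → ℝ) :
    Matrix (Fin n) (Fin n) ℝ :=
  Matrix.of fun i j => fderiv ℝ (fun z => grad h z j) x (Pi.single i 1)

/-! ### Solutions and stability of autonomous differential equations -/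

section Stability

variable {E : Type*} [NormedAddCommGroup E] [NormedSpace ℝ E]

/-- `p` is a solution of `p' = F p` on the time interval `I` that stays in the state space `M`. -/
def IsSolutionOn (F : E → E) (M : Set E) (I : Set ℝ) (p : ℝ → E) : Prop :=
  ∀ t ∈ I, p t ∈ M ∧ HasDerivWithinAt p (F (p t)) I t

/-- `q` is a (locally, Lyapunov) stable equilibrium of `p' = F p` on the state space `M`: from every
initial state close enough to `q` there is a solution for all times `t ≥ 0`, and every solution
from there stays `ε`-close to `q` as long as it is defined. -/
def IsStableEquilibrium (F : E → E) (M : Set E) (q : E) : Prop :=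
  q ∈ M ∧ F q = 0 ∧
    ∀ ε > 0, ∃ δ > 0, ∀ p₀ : E, dist p₀ q < δ →
      (∃ p : ℝ → E, p 0 = p₀ ∧ IsSolutionOn F M (Ici 0) p) ∧
      ∀ T : ℝ, 0 ≤ T → ∀ p : ℝ → E, p 0 = p₀ → IsSolutionOn F M (Icc 0 T) p →
        ∀ t ∈ Icc 0 T, dist (p t) q < ε

/-- Local asymptotic stability: stability and local attractivity. -/
def IsAsymptoticallyStableEquilibrium (F : E → E) (M : Set E) (q : E) : Prop :=
  IsStableEquilibrium F M q ∧
    ∃ δ > 0, ∀ p : ℝ → E, dist (p 0) q < δ → IsSolutionOn F M (Ici 0) p →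
      Tendsto p atTop (𝓝 q)

/-- `V` is a Lyapunov function for `p' = F p` at `q`: on an open neighbourhood of `q` it is
continuously differentiable, has its strict minimum at `q`, and does not increase along `F`. -/
def IsLyapunovFunction (V : E → ℝ) (F : E → E) (M : Set E) (q : E) : Prop :=
  ∃ U : Set E, IsOpen U ∧ q ∈ U ∧ U ⊆ M ∧ ContDiffOn ℝ 1 V U ∧
    (∀ p ∈ U, p ≠ q → V q < V p) ∧ ∀ p ∈ U, fderiv ℝ V p (F p) ≤ 0

end Stability

/-! ### The plant `x' = f(x) + g(x) u` -/

section Plant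

variable {n m r : ℕ}

/-- The assignable equilibria: the points `x` with `g^⊥(x) f(x) = 0`, where `g^⊥(x)` is a
`(n-m) × n` left annihilator of `g(x)`, of full rank.  (All of these have the same kernel if `g(x)`
has rank `m`.) -/
def assignableEquilibria (X : Set (Fin n → ℝ)) (f : (Fin n → ℝ) → Fin n → ℝ)
    (g : (Fin n → ℝ) → Matrix (Fin n) (Fin m) ℝ) : Set (Fin n → ℝ) :=
  {x | x ∈ X ∧ ∃ N : Matrix (Fin (n - m)) (Fin n) ℝ,
    N.rank = n - m ∧ N * g x = 0 ∧ N *ᵥ f x = 0}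

/-- `κ = (g⋆ᵀ g⋆)⁻¹ g⋆ᵀ f⋆`, with `f⋆ = f(x⋆)` and `g⋆ = g(x⋆)`. -/
noncomputable def kappa (f : (Fin n → ℝ) → Fin n → ℝ)
    (g : (Fin n → ℝ) → Matrix (Fin n) (Fin m) ℝ) (xs : Fin n → ℝ) : Fin m → ℝ :=
  ((g xs)ᵀ * g xs)⁻¹ *ᵥ ((g xs)ᵀ *ᵥ f xs)

/-- The storage function condition `[∇S(x)]ᵀ f(x) = -‖ℓ(x)‖²`. -/
def StorageCondition (X : Set (Fin n → ℝ)) (f : (Fin n → ℝ) → Fin n → ℝ)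
    (S : (Fin n → ℝ) → ℝ) (ℓ : (Fin n → ℝ) → Fin r → ℝ) : Prop :=
  ∀ x ∈ X, grad S x ⬝ᵥ f x = -(ℓ x ⬝ᵥ ℓ x)

/-- The passive output `y = gᵀ∇S + 2wᵀℓ + [wᵀw + D]u` at the state `x` and the input `u`. -/
noncomputable def passiveOutput (g : (Fin n → ℝ) → Matrix (Fin n) (Fin m) ℝ)
    (S : (Fin n → ℝ) → ℝ) (ℓ : (Fin n → ℝ) → Fin r → ℝ)
    (w : (Fin n → ℝ) → Matrix (Fin r) (Fin m) ℝ) (D : (Fin n → ℝ) → Matrix (Fin m) (Fin m) ℝ)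
    (x : Fin n → ℝ) (u : Fin m → ℝ) : Fin m → ℝ :=
  (g x)ᵀ *ᵥ grad S x + (2 : ℝ) • ((w x)ᵀ *ᵥ ℓ x) + ((w x)ᵀ * w x + D x) *ᵥ u

/-- The energy shaping condition on `γ` at `x⋆`, with the positive constants `α`, `β`: the passive
output is the time derivative of `γ` along the plant, for every state and every input; the vector
`∇S + ∇γ κ` vanishes at `x⋆`; and the matrix
`∇²S + ∑ᵢ αᵢ βᵢ ∇γᵢ ∇γᵢᵀ + ∇²(γᵀκ)` is positive definite at `x⋆`. -/
structure ShapingCondition (X : Set (Fin n → ℝ)) (f : (Fin n → ℝ) → Fin n → ℝ)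
    (g : (Fin n → ℝ) → Matrix (Fin n) (Fin m) ℝ) (S : (Fin n → ℝ) → ℝ)
    (ℓ : (Fin n → ℝ) → Fin r → ℝ) (w : (Fin n → ℝ) → Matrix (Fin r) (Fin m) ℝ)
    (D : (Fin n → ℝ) → Matrix (Fin m) (Fin m) ℝ) (γ : (Fin n → ℝ) → Fin m → ℝ)
    (α β : Fin m → ℝ) (xs : Fin n → ℝ) : Prop where
  output_eq : ∀ x ∈ X, ∀ u : Fin m → ℝ,
    (jac γ x)ᵀ *ᵥ (f x + g x *ᵥ u) = passiveOutput g S ℓ w D x u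
  alpha_pos : ∀ i, 0 < α i
  beta_pos : ∀ i, 0 < β i
  grad_eq : grad S xs + jac γ xs *ᵥ kappa f g xs = 0
  hess_posDef :
    (hess S xs
      + ∑ i, (α i * β i) • vecMulVec (grad (fun x => γ x i) xs) (grad (fun x => γ x i) xs)
      + hess (fun x => γ x ⬝ᵥ kappa f g xs) xs).PosDef

/-! ### The controller

The controller only sees the value `v = γ(x)` and its own state `xc`, and not the passive output;
`vs` stands for the reference value `γ⋆ = γ(x⋆)`. -/

/-- `z_c = γ(x) - γ⋆ + x_c`. -/
def zc (vs v xc : Fin m → ℝ) : Fin m → ℝ := v - vs + xc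

/-- The vector `∑ᵢ eᵢ αᵢ tanh(βᵢ zᵢ)`. -/
noncomputable def satTanh (α β z : Fin m → ℝ) : Fin m → ℝ :=
  fun i => α i * Real.tanh (β i * z i)

/-- The control law `u = -κ - ∑ᵢ eᵢ αᵢ tanh(βᵢ z_cᵢ)`. -/
noncomputable def controlLaw (κ α β vs v xc : Fin m → ℝ) : Fin m → ℝ :=
  -κ - satTanh α β (zc vs v xc)

/-- The controller dynamics `x_c' = -R_c [∑ᵢ eᵢ αᵢ tanh(βᵢ z_cᵢ) + K_c x_c]`. -/
noncomputable def controllerField (Rc Kc : Matrix (Fin m) (Fin m) ℝ)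
    (α β vs v xc : Fin m → ℝ) : Fin m → ℝ :=
  -(Rc *ᵥ (satTanh α β (zc vs v xc) + Kc *ᵥ xc))

/-- The input that the control law feeds to the plant at the closed-loop state `p = (x, x_c)`. -/
noncomputable def closedLoopInput (f : (Fin n → ℝ) → Fin n → ℝ)
    (g : (Fin n → ℝ) → Matrix (Fin n) (Fin m) ℝ) (γ : (Fin n → ℝ) → Fin m → ℝ)
    (α β : Fin m → ℝ) (xs : Fin n → ℝ) (p : (Fin n → ℝ) × (Fin m → ℝ)) : Fin m → ℝ :=
  controlLaw (kappa f g xs) α β (γ xs) (γ p.1) p.2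

/-- The vector field of the closed-loop system, on the states `p = (x, x_c)`. -/
noncomputable def closedLoop (f : (Fin n → ℝ) → Fin n → ℝ)
    (g : (Fin n → ℝ) → Matrix (Fin n) (Fin m) ℝ) (γ : (Fin n → ℝ) → Fin m → ℝ)
    (α β : Fin m → ℝ) (xs : Fin n → ℝ) (Rc Kc : Matrix (Fin m) (Fin m) ℝ)
    (p : (Fin n → ℝ) × (Fin m → ℝ)) : (Fin n → ℝ) × (Fin m → ℝ) :=
  (f p.1 + g p.1 *ᵥ closedLoopInput f g γ α β xs p,
    controllerField Rc Kc α β (γ xs) (γ p.1) p.2)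

/-- `Φ_c(z) = ∑ᵢ (αᵢ / βᵢ) ln cosh(βᵢ zᵢ)`. -/
noncomputable def Phic (α β z : Fin m → ℝ) : ℝ :=
  ∑ i, α i / β i * Real.log (Real.cosh (β i * z i))

/-- `S(x) + Φ_c(z_c) + κᵀγ(x) + ½ ‖x_c‖²_{K_c}`, where `‖x_c‖²_{K_c} = x_cᵀ K_c x_c`. -/
noncomputable def closedLoopEnergy (f : (Fin n → ℝ) → Fin n → ℝ)
    (g : (Fin n → ℝ) → Matrix (Fin n) (Fin m) ℝ) (S : (Fin n → ℝ) → ℝ)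
    (γ : (Fin n → ℝ) → Fin m → ℝ) (α β : Fin m → ℝ) (xs : Fin n → ℝ)
    (Kc : Matrix (Fin m) (Fin m) ℝ) (p : (Fin n → ℝ) × (Fin m → ℝ)) : ℝ :=
  S p.1 + Phic α β (zc (γ xs) (γ p.1) p.2) + kappa f g xs ⬝ᵥ γ p.1
    + 1 / 2 * (p.2 ⬝ᵥ Kc *ᵥ p.2)

/-- The equations `ℓ = w (κ - K_c x_c)` and `y = 0` at the closed-loop state `p = (x, x_c)`. -/
def DetectEquations (f : (Fin n → ℝ) → Fin n → ℝ)
    (g : (Fin n → ℝ) → Matrix (Fin n) (Fin m) ℝ) (S : (Fin n → ℝ) → ℝ)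
    (ℓ : (Fin n → ℝ) → Fin r → ℝ) (w : (Fin n → ℝ) → Matrix (Fin r) (Fin m) ℝ)
    (D : (Fin n → ℝ) → Matrix (Fin m) (Fin m) ℝ) (γ : (Fin n → ℝ) → Fin m → ℝ)
    (α β : Fin m → ℝ) (xs : Fin n → ℝ) (Kc : Matrix (Fin m) (Fin m) ℝ)
    (p : (Fin n → ℝ) × (Fin m → ℝ)) : Prop :=
  ℓ p.1 = w p.1 *ᵥ (kappa f g xs - Kc *ᵥ p.2) ∧
    passiveOutput g S ℓ w D p.1 (closedLoopInput f g γ α β xs p) = 0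

end Plant

/-!
Write `T = ∑ᵢ eᵢ αᵢ tanh(βᵢ z_cᵢ)`, `v = T + K_c x_c` and `u = -κ - T`. The proof is Lyapunov's
method together with LaSalle's invariance principle, for the closed-loop energy `S_d`.

*Dissipation.* The storage function condition gives the power balance `Ṡ = yᵀu - ‖ℓ + w u‖²`
(`StorageCondition.power_balance`). Since `γ̇ = y`, the terms `Φ_c` and `κᵀγ` of the energy
contribute `yᵀ(T + κ) = -yᵀu` besides the terms in `ẋ_c`, which add up to `vᵀẋ_c = -vᵀ R_c v`. So
`Ṡ_d = -‖ℓ + w u‖² - vᵀ R_c v` (`fderiv_closedLoopEnergy_closedLoop`).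

*Strict minimum.* At `q = (x⋆, 0)` the first derivative of `S_d` is `∇S + ∇γ κ = 0`, and the second
derivative in the direction `(a, b)` is
`aᵀ(∇²S + ∇²(γᵀκ))a + ∑ᵢ αᵢ βᵢ (∇γᵢᵀa + bᵢ)² + bᵀ K_c b`. For `b = 0` this is the form that is
positive definite by assumption; the cross terms are dominated as soon as `K_c ≥ k I` with `k` large
(`exists_pos_forall_quadratic_pos`). So `K₀ = k I` works for every larger gain, and the second
derivative test `eventually_lt_of_fderiv_fderiv_pos` makes `S_d` a Lyapunov function.

*Solutions.* The closed-loop field is Lipschitz near `q`. On a small closed ball it agrees with a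
bounded Lipschitz field on the whole space, whose solutions exist for all times and depend
continuously on the initial state. The sublevel sets of the Lyapunov function trap all solutions
that start close to `q`, which gives stability (`IsLyapunovFunction.isStableEquilibrium`). A
solution from a cluster point of a trapped solution has constant energy
(`IsLyapunovFunction.isAsymptoticallyStableEquilibrium`).

*Detectability.* Along a solution of constant energy `ℓ + w u = 0` and `v = 0`; so `x_c` is at rest,
`T = -K_c x_c` is constant, hence so are `z_c` and `γ`, and `y = γ̇ = 0`. As `u = -κ + K_c x_c`,
these are the equations of the detectability assumption
(`detectEquations_of_fderiv_closedLoopEnergy_eq_zero`), which leaves `q` as the only cluster point.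
-/

/-! ### Global solutions of Lipschitz differential equations -/

section LyapunovTheory

variable {E : Type*} [NormedAddCommGroup E] [NormedSpace ℝ E]

/-- The extension is obtained from the function that is `F` on the ball of radius `ρ` and `0`
outside the ball of radius `2 ρ`; this function is Lipschitz because the two pieces have a positive
distance. -/
theorem exists_bounded_lipschitzWith_eqOn_closedBall [FiniteDimensional ℝ E] {F : E → E} {q : E}
    {ρ : ℝ} (hρ : 0 < ρ) {K : NNReal} (hF : LipschitzOnWith K F (Metric.closedBall q ρ)) :
    ∃ (G : E → E) (K' L : NNReal), LipschitzWith K' G ∧ (∀ x, ‖G x‖ ≤ L) ∧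
      EqOn F G (Metric.closedBall q ρ) := by
  classical
  have := FiniteDimensional.proper_real E
  obtain ⟨C, hC⟩ := (isCompact_closedBall q ρ).exists_bound_of_continuousOn hF.continuousOn
  have hC0 : 0 ≤ C := (norm_nonneg _).trans (hC q (Metric.mem_closedBall_self hρ.le))
  let H : E → E := fun x => if x ∈ Metric.closedBall q ρ then F x else 0
  have hfar : ∀ x ∈ Metric.closedBall q ρ, ∀ y ∉ Metric.ball q (2 * ρ), C ≤ C / ρ * dist x y := by
    intro x hx y hy
    have h1 : ρ ≤ dist x y := by
      have := dist_triangle y x q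
      rw [Metric.mem_closedBall] at hx
      rw [Metric.mem_ball, not_lt] at hy
      rw [dist_comm x y]
      linarith
    calc C = C / ρ * ρ := by field_simp
      _ ≤ C / ρ * dist x y := by gcongr
  have hout : ∀ y ∉ Metric.ball q (2 * ρ), y ∉ Metric.closedBall q ρ := by
    intro y hy hy'
    rw [Metric.mem_closedBall] at hy'
    rw [Metric.mem_ball, not_lt] at hy
    linarith
  have hH : LipschitzOnWith (max K (C / ρ).toNNReal) H
      (Metric.closedBall q ρ ∪ (Metric.ball q (2 * ρ))ᶜ) := by
    have hK1 : (K : ℝ) ≤ (max K (C / ρ).toNNReal : NNReal) := by simp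
    have hK2 : C / ρ ≤ (max K (C / ρ).toNNReal : NNReal) := by simp
    refine LipschitzOnWith.of_dist_le_mul ?_
    rintro x (hx | hx) y (hy | hy)
    · simp only [H, if_pos hx, if_pos hy]
      exact (hF.dist_le_mul x hx y hy).trans (by gcongr)
    · simp only [H, if_pos hx, if_neg (hout y hy), dist_zero_right]
      exact (hC x hx).trans ((hfar x hx y hy).trans (by gcongr))
    · simp only [H, if_pos hy, if_neg (hout x hx), dist_zero_left]
      rw [dist_comm x y]
      exact (hC y hy).trans ((hfar y hy x hx).trans (by gcongr))
    · simp only [H, if_neg (hout x hx), if_neg (hout y hy), dist_self]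
      positivity
  obtain ⟨G, hG, hGH⟩ := hH.extend_finite_dimension
  obtain ⟨L, hL⟩ := (isCompact_closedBall q (2 * ρ)).exists_bound_of_continuousOn
    hG.continuous.continuousOn
  refine ⟨G, _, L.toNNReal, hG, fun x => ?_, fun x hx => ?_⟩
  · by_cases hx : x ∈ Metric.ball q (2 * ρ)
    · exact (hL x (Metric.ball_subset_closedBall hx)).trans (Real.le_coe_toNNReal L)
    · rw [← hGH (Or.inr hx)]
      simp only [H, if_neg (hout x hx), norm_zero]
      positivity
  · rw [← hGH (Or.inl hx)]
    simp only [H, if_pos hx]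

theorem exists_forall_hasDerivAt_of_lipschitzWith [CompleteSpace E] {G : E → E} {K L : NNReal}
    (hG : LipschitzWith K G) (hL : ∀ x, ‖G x‖ ≤ L) (x : E) :
    ∃ p : ℝ → E, p 0 = x ∧ ∀ t, HasDerivAt p (G (p t)) t := by
  have hloc : ∀ n : ℕ, ∃ a : ℝ → E, a 0 = x ∧
      ∀ t ∈ Icc (-(n : ℝ)) n, HasDerivWithinAt a (G (a t)) (Icc (-(n : ℝ)) n) t := by
    intro n
    have h0 : (0 : ℝ) ∈ Icc (-(n : ℝ)) n := by simp
    have hPL : IsPicardLindelof (fun _ => G) (⟨0, h0⟩ : Icc (-(n : ℝ)) n) x (L * n) 0 L K :=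
      { lipschitzOnWith := fun _ _ => hG.lipschitzOnWith
        continuousOn := fun _ _ => continuousOn_const
        norm_le := fun _ _ y _ => hL y
        mul_max_le := by simp }
    exact hPL.exists_eq_forall_mem_Icc_hasDerivWithinAt₀
  choose a ha0 ha using hloc
  have hderiv : ∀ n : ℕ, ∀ t ∈ Ioo (-(n : ℝ)) n, HasDerivAt (a n) (G (a n t)) t := fun n t ht =>
    (ha n t (Ioo_subset_Icc_self ht)).hasDerivAt (Icc_mem_nhds ht.1 ht.2)
  have hmono : ∀ n m : ℕ, n ≤ m → ∀ t ∈ Ioo (-(n : ℝ)) n, a n t = a m t := by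
    intro n m hnm t ht
    have hnm' : (n : ℝ) ≤ m := by exact_mod_cast hnm
    have hsub : Ioo (-(n : ℝ)) n ⊆ Ioo (-(m : ℝ)) m := Ioo_subset_Ioo (by linarith) hnm'
    exact ODE_solution_unique_of_mem_Ioo (v := fun _ => G) (s := fun _ => univ) (K := K)
      (t₀ := 0) (fun _ _ => hG.lipschitzOnWith)
      ⟨by linarith [ht.1, ht.2], by linarith [ht.1, ht.2]⟩
      (fun s hs => ⟨hderiv n s hs, mem_univ _⟩) (fun s hs => ⟨hderiv m s (hsub hs), mem_univ _⟩)
      (by rw [ha0, ha0]) ht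
  have hN : ∀ t : ℝ, t ∈ Ioo (-((⌈|t|⌉₊ + 1 : ℕ) : ℝ)) ((⌈|t|⌉₊ + 1 : ℕ) : ℝ) := by
    intro t
    rw [mem_Ioo, ← abs_lt]
    push_cast
    linarith [Nat.le_ceil |t|]
  have heq : ∀ n : ℕ, ∀ t ∈ Ioo (-(n : ℝ)) n, a (⌈|t|⌉₊ + 1) t = a n t := by
    intro n t ht
    rcases le_total n (⌈|t|⌉₊ + 1) with h | h
    · exact (hmono _ _ h t ht).symm
    · exact hmono _ _ h t (hN t)
  -- the value at time `t` is read off from the solution on `[-N, N]` with `N = ⌈|t|⌉ + 1`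
  refine ⟨fun t => a (⌈|t|⌉₊ + 1) t, ha0 _, fun t => ?_⟩
  refine (hderiv _ t (hN t)).congr_of_eventuallyEq ?_
  filter_upwards [Ioo_mem_nhds (hN t).1 (hN t).2] with s hs
  exact heq _ s hs

/-! ### Lyapunov functions and stability -/

theorem antitoneOn_comp_of_fderiv_apply_nonpos {F : E → E} {V : E → ℝ} {B : Set E}
    (hV : ∀ x ∈ B, DifferentiableAt ℝ V x) (hVF : ∀ x ∈ B, fderiv ℝ V x (F x) ≤ 0)
    {I : Set ℝ} (hI : Convex ℝ I) {p : ℝ → E} (hp : IsSolutionOn F B I p) :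
    AntitoneOn (V ∘ p) I := by
  have hd : ∀ t ∈ I, HasDerivWithinAt (V ∘ p) (fderiv ℝ V (p t) (F (p t))) I t := fun t ht =>
    (hV _ (hp t ht).1).hasFDerivAt.comp_hasDerivWithinAt t (hp t ht).2
  refine antitoneOn_of_hasDerivWithinAt_nonpos hI
    (fun t ht => (hd t ht).continuousWithinAt)
    (fun t ht => (hd t (interior_subset ht)).mono interior_subset)
    (fun t ht => hVF _ (hp t (interior_subset ht)).1)

theorem IsSolutionOn.mono_time {F : E → E} {M : Set E} {I J : Set ℝ} {p : ℝ → E}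
    (hp : IsSolutionOn F M I p) (h : J ⊆ I) : IsSolutionOn F M J p :=
  fun t ht => ⟨(hp t (h ht)).1, (hp t (h ht)).2.mono h⟩

theorem IsSolutionOn.continuousOn {F : E → E} {M : Set E} {I : Set ℝ} {p : ℝ → E}
    (hp : IsSolutionOn F M I p) : ContinuousOn p I :=
  fun t ht => (hp t ht).2.continuousWithinAt

/-- At the first time at which a solution would reach the sphere, the function `V` would have
increased. -/
theorem IsSolutionOn.mem_ball_of_lyapunov {F : E → E} {V : E → ℝ} {q : E} {ε c T : ℝ}
    (hV : ∀ x ∈ Metric.closedBall q ε, DifferentiableAt ℝ V x)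
    (hVF : ∀ x ∈ Metric.closedBall q ε, fderiv ℝ V x (F x) ≤ 0)
    (hc : ∀ x ∈ Metric.sphere q ε, c ≤ V x) {M : Set E} {p : ℝ → E}
    (hp : IsSolutionOn F M (Icc 0 T) p) (h0 : dist (p 0) q < ε) (hc0 : V (p 0) < c) :
    ∀ t ∈ Icc 0 T, dist (p t) q < ε := by
  by_contra! hcon
  obtain ⟨t₁, ht₁, hfar⟩ := hcon
  have hcont : ContinuousOn (fun t => dist (p t) q) (Icc 0 T) :=
    continuous_dist.comp_continuousOn (hp.continuousOn.prodMk continuousOn_const)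
  let A : Set ℝ := Icc 0 T ∩ {t | ε ≤ dist (p t) q}
  have hAcl : IsClosed A :=
    hcont.preimage_isClosed_of_isClosed isClosed_Icc isClosed_Ici
  have hAbdd : BddBelow A := ⟨0, fun t ht => ht.1.1⟩
  have hs : sInf A ∈ A := hAcl.csInf_mem ⟨t₁, ht₁, hfar⟩ hAbdd
  set s := sInf A
  have hbefore : ∀ t ∈ Ico 0 s, dist (p t) q < ε := by
    intro t ht
    by_contra! h
    exact absurd (csInf_le hAbdd ⟨⟨ht.1, ht.2.le.trans hs.1.2⟩, h⟩) (not_le.2 ht.2)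
  have hspos : 0 < s := by
    rcases hs.1.1.lt_or_eq with h | h
    · exact h
    · have := hs.2
      rw [mem_ofPred_eq, ← h] at this
      linarith
  have hsub : Icc 0 s ⊆ Icc 0 T := Icc_subset_Icc_right hs.1.2
  have hsle : ∀ t ∈ Icc 0 s, dist (p t) q ≤ ε := by
    have hcl : closure (Ico 0 s) = Icc 0 s := closure_Ico hspos.ne
    intro t ht
    rw [← hcl] at ht
    refine ContinuousWithinAt.closure_le ht
      ((hcont t (hsub (hcl ▸ ht))).mono (Ico_subset_Icc_self.trans hsub))
      continuousWithinAt_const (fun y hy => (hbefore y hy).le)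
  have hsol : IsSolutionOn F (Metric.closedBall q ε) (Icc 0 s) p := fun t ht =>
    ⟨hsle t ht, (hp.mono_time hsub t ht).2⟩
  have hanti := antitoneOn_comp_of_fderiv_apply_nonpos hV hVF (convex_Icc 0 s) hsol
  have h1 : V (p s) ≤ V (p 0) := hanti ⟨le_rfl, hspos.le⟩ ⟨hspos.le, le_rfl⟩ hspos.le
  have h2 : c ≤ V (p s) := hc _ (le_antisymm (hsle s ⟨hspos.le, le_rfl⟩) hs.2)
  linarith

/-- The Lyapunov argument for stability, on one closed ball: every field `G` that `V` does not
increase along traps its solutions. The radius `δ` depends on `V` alone, so that it serves `F` as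
well as the globally Lipschitz fields that agree with `F` on the ball. -/
theorem exists_dist_lt_of_lyapunov [FiniteDimensional ℝ E] {V : E → ℝ} {q : E} {ε : ℝ} (hε : 0 < ε)
    (hV : ∀ x ∈ Metric.closedBall q ε, DifferentiableAt ℝ V x)
    (hmin : ∀ x ∈ Metric.closedBall q ε, x ≠ q → V q < V x) :
    ∃ δ > 0, ∀ G : E → E, (∀ x ∈ Metric.closedBall q ε, fderiv ℝ V x (G x) ≤ 0) →
      ∀ (M : Set E) (p : ℝ → E) (T : ℝ), dist (p 0) q < δ → IsSolutionOn G M (Icc 0 T) p →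
        ∀ t ∈ Icc 0 T, dist (p t) q < ε := by
  have := FiniteDimensional.proper_real E
  obtain ⟨c, hcq, hc⟩ : ∃ c, V q < c ∧ ∀ x ∈ Metric.sphere q ε, c ≤ V x := by
    rcases (Metric.sphere q ε).eq_empty_or_nonempty with h | h
    · exact ⟨V q + 1, by linarith, by simp [h]⟩
    · obtain ⟨x, hx, hxmin⟩ := (isCompact_sphere q ε).exists_isMinOn h
        (fun y hy => (hV y (Metric.sphere_subset_closedBall hy)).continuousAt.continuousWithinAt)
      exact ⟨V x, hmin x (Metric.sphere_subset_closedBall hx) (Metric.ne_of_mem_sphere hx hε.ne'),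
        fun y hy => hxmin hy⟩
  have hnear : ∀ᶠ x in 𝓝 q, V x < c :=
    (hV q (Metric.mem_closedBall_self hε.le)).continuousAt.eventually_lt continuousAt_const hcq
  obtain ⟨δ, hδ, hball⟩ := Metric.eventually_nhds_iff.1 hnear
  refine ⟨min δ ε, lt_min hδ hε, fun G hVG M p T h0 hp => ?_⟩
  exact hp.mem_ball_of_lyapunov hV hVG hc (h0.trans_le (min_le_right _ _))
    (hball (h0.trans_le (min_le_left _ _)))

/-- From close to the equilibrium there is a solution for all positive times that stays in a
prescribed ball, because it is a solution of a globally Lipschitz equation trapped in this ball. -/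
theorem exists_solution_of_lyapunov [FiniteDimensional ℝ E] {F : E → E} {V : E → ℝ} {q : E}
    {ε : ℝ} (hε : 0 < ε) (hV : ∀ x ∈ Metric.closedBall q ε, DifferentiableAt ℝ V x)
    (hmin : ∀ x ∈ Metric.closedBall q ε, x ≠ q → V q < V x)
    (hVF : ∀ x ∈ Metric.closedBall q ε, fderiv ℝ V x (F x) ≤ 0)
    {K : NNReal} (hF : LipschitzOnWith K F (Metric.closedBall q ε)) :
    ∃ δ > 0, ∀ p₀ : E, dist p₀ q < δ →
      ∃ p : ℝ → E, p 0 = p₀ ∧ IsSolutionOn F (Metric.closedBall q ε) (Ici 0) p := by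
  obtain ⟨G, K', L, hG, hL, hFG⟩ := exists_bounded_lipschitzWith_eqOn_closedBall hε hF
  have := FiniteDimensional.complete ℝ E
  obtain ⟨δ, hδ, htrap⟩ := exists_dist_lt_of_lyapunov hε hV hmin
  refine ⟨δ, hδ, fun p₀ hp₀ => ?_⟩
  obtain ⟨p, hp0, hp⟩ := exists_forall_hasDerivAt_of_lipschitzWith hG hL p₀
  have hmem : ∀ t ∈ Ici (0 : ℝ), p t ∈ Metric.closedBall q ε := fun t ht =>
    (htrap G (fun x hx => hFG hx ▸ hVF x hx) univ p t (hp0 ▸ hp₀)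
      (fun s _ => ⟨mem_univ _, (hp s).hasDerivWithinAt⟩) t ⟨ht, le_rfl⟩).le
  exact ⟨p, hp0, fun t ht => ⟨hmem t ht, hFG (hmem t ht) ▸ (hp t).hasDerivWithinAt⟩⟩

/-- A radius that fits into a given neighbourhood and on which the Lyapunov function and the
Lipschitz estimate are available. -/
theorem IsLyapunovFunction.exists_closedBall {F : E → E} {V : E → ℝ} {M : Set E}
    {q : E} (hLyap : IsLyapunovFunction V F M q)
    (hLip : ∃ K, ∃ s ∈ 𝓝 q, LipschitzOnWith K F s) {N : Set E} (hN : N ∈ 𝓝 q) :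
    ∃ ε > 0, Metric.closedBall q ε ⊆ N ∩ M ∧
      (∀ x ∈ Metric.closedBall q ε, DifferentiableAt ℝ V x) ∧
      (∀ x ∈ Metric.closedBall q ε, x ≠ q → V q < V x) ∧
      (∀ x ∈ Metric.closedBall q ε, fderiv ℝ V x (F x) ≤ 0) ∧
      ∃ K, LipschitzOnWith K F (Metric.closedBall q ε) := by
  obtain ⟨U, hU, hqU, hUM, hVC, hmin, hVF⟩ := hLyap
  obtain ⟨K, s, hs, hK⟩ := hLip
  obtain ⟨ε, hε, hball⟩ := Metric.nhds_basis_closedBall.mem_iff.1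
    (inter_mem (inter_mem hN (hU.mem_nhds hqU)) hs)
  have hBU : Metric.closedBall q ε ⊆ U := fun x hx => (hball hx).1.2
  exact ⟨ε, hε, fun x hx => ⟨(hball hx).1.1, hUM (hBU hx)⟩,
    fun x hx => (hVC.differentiableOn one_ne_zero).differentiableAt (hU.mem_nhds (hBU hx)),
    fun x hx => hmin x (hBU hx), fun x hx => hVF x (hBU hx),
    K, hK.mono fun x hx => (hball hx).2⟩

/-- **Lyapunov's stability theorem.** -/
theorem IsLyapunovFunction.isStableEquilibrium [FiniteDimensional ℝ E] {F : E → E} {V : E → ℝ}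
    {M : Set E} {q : E} (hLyap : IsLyapunovFunction V F M q) (hq : F q = 0)
    (hLip : ∃ K, ∃ s ∈ 𝓝 q, LipschitzOnWith K F s) : IsStableEquilibrium F M q := by
  obtain ⟨U, _, hqU, hUM, _⟩ := id hLyap
  refine ⟨hUM hqU, hq, fun ε hε => ?_⟩
  obtain ⟨ρ, hρ, hsub, hV, hmin, hVF, K, hK⟩ :=
    hLyap.exists_closedBall hLip (Metric.ball_mem_nhds q hε)
  obtain ⟨δ₁, hδ₁, hex⟩ := exists_solution_of_lyapunov hρ hV hmin hVF hK
  obtain ⟨δ₂, hδ₂, htrap⟩ := exists_dist_lt_of_lyapunov hρ hV hmin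
  refine ⟨min δ₁ δ₂, lt_min hδ₁ hδ₂, fun p₀ hp₀ => ⟨?_, ?_⟩⟩
  · obtain ⟨p, hp0, hp⟩ := hex p₀ (hp₀.trans_le (min_le_left _ _))
    exact ⟨p, hp0, fun t ht => ⟨(hsub (hp t ht).1).2, (hp t ht).2⟩⟩
  · intro T _ p hp0 hp t ht
    have h : dist (p t) q < ρ :=
      htrap F hVF M p T (hp0 ▸ hp₀.trans_le (min_le_right _ _)) hp t ht
    exact (hsub h.le).1

/-- **LaSalle's invariance principle** for an equilibrium with a Lyapunov function. A cluster point
`z` of a bounded solution `p` is `q`: the solution from `z` is a limit of time shifts of `p`, so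
that `V` is constant along it, and the hypothesis `hinv` applies. -/
theorem IsLyapunovFunction.isAsymptoticallyStableEquilibrium [FiniteDimensional ℝ E] {F : E → E}
    {V : E → ℝ} {M : Set E} {q : E} (hLyap : IsLyapunovFunction V F M q) (hq : F q = 0)
    (hLip : ∃ K, ∃ s ∈ 𝓝 q, LipschitzOnWith K F s) {Ω : Set E} (hΩ : Ω ∈ 𝓝 q)
    (hinv : ∀ p : ℝ → E, IsSolutionOn F Ω (Ici 0) p →
      (∀ t ∈ Ici (0 : ℝ), fderiv ℝ V (p t) (F (p t)) = 0) → p 0 = q) :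
    IsAsymptoticallyStableEquilibrium F M q := by
  have := FiniteDimensional.proper_real E
  have := FiniteDimensional.complete ℝ E
  refine ⟨hLyap.isStableEquilibrium hq hLip, ?_⟩
  obtain ⟨ρ, hρ, hsub, hV, hmin, hVF, K, hK⟩ := hLyap.exists_closedBall hLip hΩ
  obtain ⟨δ, hδ, htrap⟩ := exists_dist_lt_of_lyapunov hρ hV hmin
  refine ⟨δ, hδ, fun p hp0 hp => ?_⟩
  have hpB : ∀ t ∈ Ici (0 : ℝ), p t ∈ Metric.closedBall q ρ := fun t ht =>
    (htrap F hVF M p t hp0 (hp.mono_time Icc_subset_Ici_self) t ⟨ht, le_rfl⟩).le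
  have hpsol : IsSolutionOn F (Metric.closedBall q ρ) (Ici 0) p := fun t ht =>
    ⟨hpB t ht, (hp t ht).2⟩
  have hanti : AntitoneOn (V ∘ p) (Ici 0) :=
    antitoneOn_comp_of_fderiv_apply_nonpos hV hVF (convex_Ici 0) hpsol
  have hVcont : ∀ x ∈ Metric.closedBall q ρ, ContinuousAt V x := fun x hx => (hV x hx).continuousAt
  have hlow : ∀ x ∈ Metric.closedBall q ρ, V q ≤ V x := by
    intro x hx
    rcases eq_or_ne x q with rfl | h
    · exact le_rfl
    · exact (hmin x hx h).le
  obtain ⟨c, hc⟩ : ∃ c, Tendsto (V ∘ p) atTop (𝓝 c) := by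
    have hanti' : Antitone fun t : ℝ => V (p (max t 0)) := fun s t hst =>
      hanti (mem_Ici.2 (le_max_right s 0)) (mem_Ici.2 (le_max_right t 0)) (max_le_max_right 0 hst)
    refine ⟨_, (tendsto_atTop_ciInf hanti' ⟨V q, ?_⟩).congr' ?_⟩
    · rintro _ ⟨t, rfl⟩
      exact hlow _ (hpB _ (mem_Ici.2 (le_max_right t 0)))
    · filter_upwards [eventually_ge_atTop (0 : ℝ)] with t ht
      simp [max_eq_left ht]
  obtain ⟨G, K', L, hG, hL, hFG⟩ := exists_bounded_lipschitzWith_eqOn_closedBall hρ hK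
  refine (isCompact_closedBall q ρ).tendsto_nhds_of_unique_mapClusterPt
    ((eventually_ge_atTop 0).mono hpB) fun z hz hcl => ?_
  obtain ⟨𝒰, h𝒰, hz𝒰⟩ := mapClusterPt_iff_ultrafilter.1 hcl
  obtain ⟨φ, hφ0, hφ⟩ := exists_forall_hasDerivAt_of_lipschitzWith hG hL z
  -- by Grönwall's inequality, closeness of `p t` to `z` persists for the time `s`
  have hlim : ∀ s ∈ Ici (0 : ℝ), Tendsto (fun t => p (t + s)) 𝒰 (𝓝 (φ s)) := by
    intro s hs
    have hbound : ∀ t ∈ Ici (0 : ℝ), dist (p (t + s)) (φ s) ≤ dist (p t) z * Real.exp (K' * s) := by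
      intro t ht
      have hd : ∀ σ ∈ Ici (0 : ℝ),
          HasDerivWithinAt (fun σ => p (t + σ)) (G (p (t + σ))) (Ici 0) σ := by
        intro σ hσ
        have htσ : t + σ ∈ Ici (0 : ℝ) := add_nonneg (mem_Ici.1 ht) (mem_Ici.1 hσ)
        have h1 := (hpsol (t + σ) htσ).2
        rw [hFG (hpB _ htσ)] at h1
        have h2 : HasDerivWithinAt (fun σ : ℝ => t + σ) 1 (Ici 0) σ :=
          ((hasDerivAt_id σ).const_add t).hasDerivWithinAt
        have h3 := HasDerivWithinAt.scomp (t' := Ici 0) σ h1 h2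
          (fun τ hτ => add_nonneg (mem_Ici.1 ht) (mem_Ici.1 hτ))
        simpa [Function.comp_def] using h3
      have := dist_le_of_trajectories_ODE (v := fun _ => G) (K := K')
        (f := fun σ => p (t + σ)) (g := φ) (a := 0) (b := s) (δ := dist (p t) z)
        (fun _ => hG) (fun σ hσ => ((hd σ hσ.1).continuousWithinAt).mono Icc_subset_Ici_self)
        (fun σ hσ => (hd σ hσ.1).mono (Ici_subset_Ici.2 hσ.1))
        (fun σ _ => (hφ σ).continuousAt.continuousWithinAt)
        (fun σ _ => (hφ σ).hasDerivWithinAt) (by simp [hφ0]) s ⟨hs, le_rfl⟩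
      simpa using this
    have hzero : Tendsto (fun t => dist (p t) z * Real.exp (K' * s)) 𝒰 (𝓝 0) := by
      simpa using (tendsto_iff_dist_tendsto_zero.1 hz𝒰).mul_const (Real.exp (K' * s))
    rw [tendsto_iff_dist_tendsto_zero]
    refine squeeze_zero' (Eventually.of_forall fun _ => dist_nonneg) ?_ hzero
    exact h𝒰 ((eventually_ge_atTop 0).mono hbound)
  have hφB : ∀ s ∈ Ici (0 : ℝ), φ s ∈ Metric.closedBall q ρ := fun s hs =>
    Metric.isClosed_closedBall.mem_of_tendsto (hlim s hs)
      (h𝒰 ((eventually_ge_atTop 0).mono fun t ht => hpB _ (add_nonneg ht hs)))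
  have hVφ : ∀ s ∈ Ici (0 : ℝ), V (φ s) = c := by
    intro s hs
    refine tendsto_nhds_unique ((hVcont _ (hφB s hs)).tendsto.comp (hlim s hs)) ?_
    exact (hc.comp (tendsto_atTop_add_const_right _ s tendsto_id)).mono_left h𝒰
  have hφsol : IsSolutionOn F (Metric.closedBall q ρ) (Ici 0) φ := fun s hs =>
    ⟨hφB s hs, (hFG (hφB s hs)).symm ▸ (hφ s).hasDerivWithinAt⟩
  rw [← hφ0]
  refine hinv φ (fun s hs => ⟨(hsub (hφB s hs)).1, (hφsol s hs).2⟩) fun s hs => ?_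
  have h1 : HasDerivWithinAt (V ∘ φ) (fderiv ℝ V (φ s) (F (φ s))) (Ici 0) s :=
    (hV _ (hφB s hs)).hasFDerivAt.comp_hasDerivWithinAt s (hφsol s hs).2
  have h2 : HasDerivWithinAt (V ∘ φ) 0 (Ici 0) s :=
    (hasDerivWithinAt_const s (Ici 0) c).congr (fun t ht => hVφ t ht) (hVφ s hs)
  exact (uniqueDiffOn_Ici (0 : ℝ) s hs).eq_deriv _ h1 h2

end LyapunovTheory

/-! ### Strict minima by the second derivative -/

section SecondDerivative

variable {E : Type*} [NormedAddCommGroup E] [NormedSpace ℝ E] [FiniteDimensional ℝ E]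

theorem exists_pos_mul_sq_norm_le {Q : E → ℝ} (hQ : Continuous Q)
    (hom : ∀ (t : ℝ) (h : E), Q (t • h) = t ^ 2 * Q h) (hpos : ∀ h, h ≠ 0 → 0 < Q h) :
    ∃ c > 0, ∀ h, c * ‖h‖ ^ 2 ≤ Q h := by
  have := FiniteDimensional.proper_real E
  have hQ0 : Q 0 = 0 := by simpa using hom 0 0
  rcases (Metric.sphere (0 : E) 1).eq_empty_or_nonempty with hemp | hne
  · refine ⟨1, one_pos, fun h => ?_⟩
    by_cases hh : h = 0
    · simp [hh, hQ0]
    · have : ‖h‖⁻¹ • h ∈ Metric.sphere (0 : E) 1 := by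
        simp [norm_smul, norm_ne_zero_iff.2 hh]
      rw [hemp] at this
      exact this.elim
  · obtain ⟨e, he, hmin⟩ := (isCompact_sphere (0 : E) 1).exists_isMinOn hne hQ.continuousOn
    refine ⟨Q e, hpos e (Metric.ne_of_mem_sphere he one_ne_zero), fun h => ?_⟩
    by_cases hh : h = 0
    · simp [hh, hQ0]
    · have hn : ‖h‖ ≠ 0 := norm_ne_zero_iff.2 hh
      have hs : ‖h‖⁻¹ • h ∈ Metric.sphere (0 : E) 1 := by simp [norm_smul, hn]
      have h1 : Q e ≤ Q (‖h‖⁻¹ • h) := hmin hs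
      have h2 : Q h = ‖h‖ ^ 2 * Q (‖h‖⁻¹ • h) := by
        rw [← hom, smul_smul, mul_inv_cancel₀ hn, one_smul]
      rw [h2, mul_comm]
      gcongr

/-- The second derivative test for a strict minimum: on a small ball the radial derivative of `V` is
positive, so `V` strictly increases along every ray from `q`. -/
theorem eventually_lt_of_fderiv_fderiv_pos {V : E → ℝ} {q : E} {H : E →L[ℝ] E →L[ℝ] ℝ}
    (hd : ∀ᶠ x in 𝓝 q, DifferentiableAt ℝ V x) (h0 : fderiv ℝ V q = 0)
    (hH : HasFDerivAt (fderiv ℝ V) H q) (hpos : ∀ h, h ≠ 0 → 0 < H h h) :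
    ∀ᶠ x in 𝓝 q, x ≠ q → V q < V x := by
  obtain ⟨c, hc, hcoer⟩ := exists_pos_mul_sq_norm_le (Q := fun h => H h h) (by fun_prop)
    (fun t h => by simp; ring) hpos
  have hsmall : ∀ᶠ x in 𝓝 q, ‖fderiv ℝ V x - H (x - q)‖ ≤ c / 2 * ‖x - q‖ := by
    simpa [h0] using hH.isLittleO.def (half_pos hc)
  have hradial : ∀ᶠ x in 𝓝 q, x ≠ q → 0 < fderiv ℝ V x (x - q) := by
    filter_upwards [hsmall] with x hx hne
    have hn : 0 < ‖x - q‖ := norm_pos_iff.2 (sub_ne_zero.2 hne)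
    have h1 : |(fderiv ℝ V x - H (x - q)) (x - q)| ≤ c / 2 * ‖x - q‖ * ‖x - q‖ :=
      ((fderiv ℝ V x - H (x - q)).le_opNorm (x - q)).trans (by gcongr)
    have h2 := (abs_le.1 h1).1
    have h3 := hcoer (x - q)
    rw [_root_.sub_apply] at h2
    nlinarith [mul_pos hc (mul_pos hn hn)]
  obtain ⟨r, hr, hball⟩ := Metric.eventually_nhds_iff_ball.1 (hd.and hradial)
  filter_upwards [Metric.ball_mem_nhds q hr] with x hx hne
  have hmem : ∀ t ∈ Icc (0 : ℝ) 1, q + t • (x - q) ∈ Metric.ball q r := by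
    intro t ht
    rw [Metric.mem_ball, dist_eq_norm] at hx ⊢
    rw [add_sub_cancel_left, norm_smul, Real.norm_of_nonneg ht.1]
    exact (mul_le_of_le_one_left (norm_nonneg _) ht.2).trans_lt hx
  have hderiv : ∀ t ∈ Icc (0 : ℝ) 1, HasDerivAt (fun t : ℝ => V (q + t • (x - q)))
      (fderiv ℝ V (q + t • (x - q)) (x - q)) t := by
    intro t ht
    have h1 : HasDerivAt (fun t : ℝ => q + t • (x - q)) (x - q) t := by
      simpa using ((hasDerivAt_id t).smul_const (x - q)).const_add q
    exact (hball _ (hmem t ht)).1.hasFDerivAt.comp_hasDerivAt t h1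
  have hmono : StrictMonoOn (fun t : ℝ => V (q + t • (x - q))) (Icc 0 1) := by
    refine strictMonoOn_of_deriv_pos (convex_Icc 0 1)
      (fun t ht => (hderiv t ht).continuousAt.continuousWithinAt) fun t ht => ?_
    rw [interior_Icc] at ht
    rw [(hderiv t (Ioo_subset_Icc_self ht)).deriv]
    have hxq : x - q ≠ 0 := sub_ne_zero.2 hne
    have h2 := (hball _ (hmem t (Ioo_subset_Icc_self ht))).2
      (by simp [ht.1.ne', hxq])
    rw [add_sub_cancel_left, map_smul, smul_eq_mul] at h2
    exact pos_of_mul_pos_right h2 ht.1.le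
  have := hmono (left_mem_Icc.2 zero_le_one) (right_mem_Icc.2 zero_le_one) one_pos
  simpa using this

end SecondDerivative

/-! ### The quadratic form of the closed-loop energy -/

/-- Only the cross terms `2 λᵢ fᵢ(a) bᵢ` can be negative; Young's inequality with a small weight
bounds them by half of `Q a` plus a multiple of `b ⬝ᵥ b`, which a large `k` outweighs. -/
theorem exists_pos_forall_quadratic_pos {E : Type*} [NormedAddCommGroup E] [NormedSpace ℝ E]
    [FiniteDimensional ℝ E] {m : ℕ} {Q : E → ℝ} (hQ : Continuous Q)
    (hom : ∀ (t : ℝ) (h : E), Q (t • h) = t ^ 2 * Q h) (hpos : ∀ h, h ≠ 0 → 0 < Q h)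
    (lam : Fin m → ℝ) (hlam : ∀ i, 0 < lam i) (φ : Fin m → E →L[ℝ] ℝ) :
    ∃ k > 0, ∀ (a : E) (b : Fin m → ℝ), (a ≠ 0 ∨ b ≠ 0) →
      0 < Q a + ∑ i, lam i * (2 * φ i a * b i + b i ^ 2) + k * (b ⬝ᵥ b) := by
  obtain ⟨c, hc, hcoer⟩ := exists_pos_mul_sq_norm_le hQ hom hpos
  set B : ℝ := ∑ i, lam i * ‖φ i‖ ^ 2
  have hB0 : 0 ≤ B := Finset.sum_nonneg fun i _ => mul_nonneg (hlam i).le (sq_nonneg _)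
  have hB : ∀ a, ∑ i, lam i * φ i a ^ 2 ≤ B * ‖a‖ ^ 2 := by
    intro a
    rw [Finset.sum_mul]
    refine Finset.sum_le_sum fun i _ => ?_
    have h1 : φ i a ^ 2 ≤ (‖φ i‖ * ‖a‖) ^ 2 := by
      rw [← sq_abs]
      exact pow_le_pow_left₀ (abs_nonneg _) ((φ i).le_opNorm a) 2
    calc lam i * φ i a ^ 2 ≤ lam i * (‖φ i‖ * ‖a‖) ^ 2 := by
          have := (hlam i).le
          gcongr
      _ = lam i * ‖φ i‖ ^ 2 * ‖a‖ ^ 2 := by ring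
  -- the weight in Young's inequality is chosen such that `ε * B ≤ c / 2`
  set ε : ℝ := c / (2 * (B + 1))
  have hε : 0 < ε := by positivity
  have hεB : ε * B ≤ c / 2 := by
    have : ε * (B + 1) = c / 2 := by
      simp only [ε]
      field_simp
    nlinarith
  have hsum0 : 0 ≤ ∑ i, lam i / ε := Finset.sum_nonneg fun i _ => (div_pos (hlam i) hε).le
  refine ⟨1 + ∑ i, lam i / ε, by positivity, fun a b hab => ?_⟩
  have hyoung : ∀ i, -(ε * (lam i * φ i a ^ 2)) - (∑ j, lam j / ε) * (b i * b i)
      ≤ lam i * (2 * φ i a * b i + b i ^ 2) := by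
    intro i
    have h1 : lam i / ε ≤ ∑ j, lam j / ε :=
      Finset.single_le_sum (f := fun j => lam j / ε) (fun j _ => (div_pos (hlam j) hε).le)
        (Finset.mem_univ i)
    have h2 : lam i / ε * (b i * b i) ≤ (∑ j, lam j / ε) * (b i * b i) :=
      mul_le_mul_of_nonneg_right h1 (mul_self_nonneg _)
    have h3 : 0 ≤ lam i / ε * (ε * φ i a + b i) ^ 2 :=
      mul_nonneg (div_pos (hlam i) hε).le (sq_nonneg _)
    have h4 : lam i / ε * (ε * φ i a + b i) ^ 2
        = ε * (lam i * φ i a ^ 2) + lam i * (2 * φ i a * b i) + lam i / ε * (b i * b i) := by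
      field_simp
      ring
    have h5 : 0 ≤ lam i * b i ^ 2 := mul_nonneg (hlam i).le (sq_nonneg _)
    linarith
  have hS := Finset.sum_le_sum fun i (_ : i ∈ Finset.univ) => hyoung i
  rw [Finset.sum_sub_distrib, Finset.sum_neg_distrib, ← Finset.mul_sum, ← Finset.mul_sum] at hS
  change _ - _ * (b ⬝ᵥ b) ≤ _ at hS
  have h6 : ε * ∑ i, lam i * φ i a ^ 2 ≤ c / 2 * ‖a‖ ^ 2 :=
    calc ε * ∑ i, lam i * φ i a ^ 2 ≤ ε * (B * ‖a‖ ^ 2) := by gcongr; exact hB a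
      _ = ε * B * ‖a‖ ^ 2 := by ring
      _ ≤ c / 2 * ‖a‖ ^ 2 := by gcongr
  have hbb : 0 ≤ b ⬝ᵥ b := by simpa using dotProduct_self_star_nonneg b
  have hlow : c / 2 * ‖a‖ ^ 2 + b ⬝ᵥ b
      ≤ Q a + ∑ i, lam i * (2 * φ i a * b i + b i ^ 2) + (1 + ∑ i, lam i / ε) * (b ⬝ᵥ b) := by
    have := hcoer a
    linarith
  refine lt_of_lt_of_le ?_ hlow
  rcases hab with ha | hb
  · have : 0 < ‖a‖ := norm_pos_iff.2 ha
    positivity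
  · have : 0 < b ⬝ᵥ b := lt_of_le_of_ne hbb fun h => hb (dotProduct_self_eq_zero.1 h.symm)
    positivity

/-! ### Gradient, Jacobian and Hessian as derivatives -/

section Calculus

variable {n m : ℕ}

theorem sum_smul_single_one (a : Fin n → ℝ) : ∑ i, a i • (Pi.single i 1 : Fin n → ℝ) = a := by
  ext j
  simp [Finset.sum_apply, Pi.single_apply]

theorem ContinuousLinearMap.apply_eq_sum_single {F : Type*} [NormedAddCommGroup F]
    [NormedSpace ℝ F] (φ : (Fin n → ℝ) →L[ℝ] F) (a : Fin n → ℝ) :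
    φ a = ∑ i, a i • φ (Pi.single i 1) := by
  conv_lhs => rw [← sum_smul_single_one a]
  simp

theorem fderiv_apply_eq_grad_dotProduct (h : (Fin n → ℝ) → ℝ) (x a : Fin n → ℝ) :
    fderiv ℝ h x a = grad h x ⬝ᵥ a := by
  rw [ContinuousLinearMap.apply_eq_sum_single]
  simp [dotProduct, grad, mul_comm]

theorem transpose_jac_mulVec_apply (F : (Fin n → ℝ) → Fin m → ℝ) (x a : Fin n → ℝ) (j : Fin m) :
    ((jac F x)ᵀ *ᵥ a) j = fderiv ℝ (fun z => F z j) x a := by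
  rw [fderiv_apply_eq_grad_dotProduct]
  rfl

theorem fderiv_fderiv_apply_eq_hess {h : (Fin n → ℝ) → ℝ} {x : Fin n → ℝ}
    (hh : DifferentiableAt ℝ (fderiv ℝ h) x) (a : Fin n → ℝ) :
    fderiv ℝ (fderiv ℝ h) x a a = a ⬝ᵥ hess h x *ᵥ a := by
  have hgrad : ∀ i j, hess h x i j
      = fderiv ℝ (fderiv ℝ h) x (Pi.single i 1) (Pi.single j 1) := by
    intro i j
    change fderiv ℝ (fun z => fderiv ℝ h z (Pi.single j 1)) x (Pi.single i 1) = _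
    rw [fderiv_clm_apply hh (differentiableAt_const _)]
    simp
  rw [ContinuousLinearMap.apply_eq_sum_single (fderiv ℝ (fderiv ℝ h) x) a]
  simp only [_root_.sum_apply, _root_.smul_apply, smul_eq_mul,
    dotProduct, mulVec, hgrad]
  refine Finset.sum_congr rfl fun i _ => ?_
  rw [ContinuousLinearMap.apply_eq_sum_single (fderiv ℝ (fderiv ℝ h) x (Pi.single i 1)) a]
  congr 1
  exact Finset.sum_congr rfl fun j _ => by rw [smul_eq_mul, mul_comm]

theorem contDiff_tanh {k : WithTop ℕ∞} : ContDiff ℝ k Real.tanh := by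
  have : Real.tanh = fun x => Real.sinh x / Real.cosh x := funext Real.tanh_eq_sinh_div_cosh
  rw [this]
  exact Real.contDiff_sinh.div Real.contDiff_cosh fun x => (Real.cosh_pos x).ne'

theorem hasDerivAt_tanh_zero : HasDerivAt Real.tanh 1 0 := by
  have : Real.tanh = fun x => Real.sinh x / Real.cosh x := funext Real.tanh_eq_sinh_div_cosh
  rw [this]
  simpa using (Real.hasDerivAt_sinh 0).fun_div (Real.hasDerivAt_cosh 0) (Real.cosh_pos 0).ne'

theorem hasDerivAt_log_cosh (x : ℝ) :
    HasDerivAt (fun x => Real.log (Real.cosh x)) (Real.tanh x) x := by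
  rw [Real.tanh_eq_sinh_div_cosh]
  exact (Real.hasDerivAt_cosh x).log (Real.cosh_pos x).ne'

end Calculus

/-! ### The equilibrium and the power balance -/

section Plant

variable {n m r : ℕ}

/-- The kernel of the left annihilator is the range of `g(x)` by rank-nullity, hence `f(x) = g(x) a`
for some `a`, and then `a = κ`. -/
theorem mulVec_kappa_of_mem_assignableEquilibria {X : Set (Fin n → ℝ)}
    {f : (Fin n → ℝ) → Fin n → ℝ} {g : (Fin n → ℝ) → Matrix (Fin n) (Fin m) ℝ} {x : Fin n → ℝ}
    (hx : x ∈ assignableEquilibria X f g) (hrank : (g x).rank = m) :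
    g x *ᵥ kappa f g x = f x := by
  obtain ⟨-, N, hN, hNg, hNf⟩ := hx
  have hmn : m ≤ n := by
    have := (g x).rank_le_height
    omega
  have hle : LinearMap.range (g x).mulVecLin ≤ LinearMap.ker N.mulVecLin := by
    rintro _ ⟨a, rfl⟩
    simp [hNg]
  have hker : Module.finrank ℝ (LinearMap.ker N.mulVecLin) = m := by
    have h := N.mulVecLin.finrank_range_add_finrank_ker
    have h' : Module.finrank ℝ (LinearMap.range N.mulVecLin) = n - m := hN
    rw [h', Module.finrank_fin_fun] at h
    omega
  have heq := Submodule.eq_of_le_of_finrank_eq hle (by rw [hker]; exact hrank)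
  have hf : f x ∈ LinearMap.range (g x).mulVecLin := by
    rw [heq]
    exact hNf
  obtain ⟨a, ha⟩ := hf
  rw [mulVecLin_apply] at ha
  have hunit : IsUnit ((g x)ᵀ * g x) := by
    rw [← mulVec_surjective_iff_isUnit]
    have h : Module.finrank ℝ (LinearMap.range ((g x)ᵀ * g x).mulVecLin) = m := by
      exact (rank_transpose_mul_self (g x)).trans hrank
    exact LinearMap.range_eq_top.1
      (Submodule.eq_top_of_finrank_eq (by rw [h, Module.finrank_fin_fun]))
  have hκ : kappa f g x = a := by
    rw [kappa, ← ha, mulVec_mulVec, mulVec_mulVec, Matrix.mul_assoc,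
      nonsing_inv_mul _ ((isUnit_iff_isUnit_det _).1 hunit), one_mulVec]
  rw [hκ, ha]

theorem dotProduct_mulVec_self_of_skew {A : Matrix (Fin m) (Fin m) ℝ} (hA : A = -Aᵀ)
    (u : Fin m → ℝ) : (A *ᵥ u) ⬝ᵥ u = 0 := by
  have h : (A *ᵥ u) ⬝ᵥ u = -((A *ᵥ u) ⬝ᵥ u) := by
    conv_lhs => rw [hA]
    rw [neg_mulVec, neg_dotProduct, mulVec_transpose, ← dotProduct_mulVec, dotProduct_comm]
  linarith

theorem transpose_mulVec_dotProduct {p : ℕ} (A : Matrix (Fin p) (Fin m) ℝ) (a : Fin p → ℝ)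
    (u : Fin m → ℝ) : (Aᵀ *ᵥ a) ⬝ᵥ u = a ⬝ᵥ A *ᵥ u := by
  rw [mulVec_transpose, ← dotProduct_mulVec]

/-- The power balance of the plant, `Ṡ = yᵀu - ‖ℓ + w u‖²`. -/
theorem StorageCondition.power_balance {X : Set (Fin n → ℝ)} {f : (Fin n → ℝ) → Fin n → ℝ}
    {g : (Fin n → ℝ) → Matrix (Fin n) (Fin m) ℝ} {S : (Fin n → ℝ) → ℝ}
    {ℓ : (Fin n → ℝ) → Fin r → ℝ} {w : (Fin n → ℝ) → Matrix (Fin r) (Fin m) ℝ}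
    {D : (Fin n → ℝ) → Matrix (Fin m) (Fin m) ℝ} (hSf : StorageCondition X f S ℓ)
    {x : Fin n → ℝ} (hx : x ∈ X) (hD : D x = -(D x)ᵀ) (u : Fin m → ℝ) :
    grad S x ⬝ᵥ (f x + g x *ᵥ u) = passiveOutput g S ℓ w D x u ⬝ᵥ u
      - (ℓ x + w x *ᵥ u) ⬝ᵥ (ℓ x + w x *ᵥ u) := by
  have h1 : (((w x)ᵀ * w x) *ᵥ u) ⬝ᵥ u = (w x *ᵥ u) ⬝ᵥ (w x *ᵥ u) := by
    rw [← mulVec_mulVec, transpose_mulVec_dotProduct]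
  simp only [passiveOutput, add_mulVec, add_dotProduct, dotProduct_add, smul_dotProduct,
    transpose_mulVec_dotProduct, h1, dotProduct_mulVec_self_of_skew hD, hSf x hx, smul_eq_mul]
  rw [dotProduct_comm (w x *ᵥ u) (ℓ x)]
  ring

end Plant

/-! ### The closed-loop energy -/

section ClosedLoop

variable {n m r : ℕ}

theorem hasDerivAt_add_smul {F : Type*} [NormedAddCommGroup F] [NormedSpace ℝ F] (p v : F) :
    HasDerivAt (fun t : ℝ => p + t • v) v 0 := by
  simpa using ((hasDerivAt_id (0 : ℝ)).smul_const v).const_add p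

theorem hasDerivAt_comp_line {F : Type*} [NormedAddCommGroup F] [NormedSpace ℝ F] {h : F → ℝ}
    {p : F} (hh : DifferentiableAt ℝ h p) (v : F) :
    HasDerivAt (fun t : ℝ => h (p + t • v)) (fderiv ℝ h p v) 0 := by
  have h' : HasFDerivAt h (fderiv ℝ h p) (p + (0 : ℝ) • v) := by
    simpa using hh.hasFDerivAt
  exact h'.comp_hasDerivAt 0 (hasDerivAt_add_smul p v)

theorem differentiableAt_fderiv {F : Type*} [NormedAddCommGroup F] [NormedSpace ℝ F] {h : F → ℝ}
    {p : F} (hh : ContDiffAt ℝ 2 h p) : DifferentiableAt ℝ (fderiv ℝ h) p :=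
  (hh.fderiv_right (m := 1) (by norm_num)).differentiableAt one_ne_zero

theorem hasDerivAt_fderiv_line {F : Type*} [NormedAddCommGroup F] [NormedSpace ℝ F] {h : F → ℝ}
    {p : F} (hh : DifferentiableAt ℝ (fderiv ℝ h) p) (v : F) :
    HasDerivAt (fun t : ℝ => fderiv ℝ h (p + t • v) v) (fderiv ℝ (fderiv ℝ h) p v v) 0 := by
  have h1 := hasDerivAt_comp_line (hh.clm_apply (differentiableAt_const v)) v
  rw [fderiv_clm_apply hh (differentiableAt_const v)] at h1
  refine h1.congr_deriv ?_
  simp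

theorem contDiff_dotProduct_mulVec {k : WithTop ℕ∞} (K : Matrix (Fin m) (Fin m) ℝ) :
    ContDiff ℝ k fun b : Fin m → ℝ => b ⬝ᵥ K *ᵥ b := by
  simp only [dotProduct, mulVec]
  fun_prop

theorem dotProduct_mulVec_comm_of_isHermitian {K : Matrix (Fin m) (Fin m) ℝ} (hK : K.IsHermitian)
    (a b : Fin m → ℝ) : a ⬝ᵥ K *ᵥ b = b ⬝ᵥ K *ᵥ a := by
  have hT : Kᵀ = K := by simpa using hK.eq
  rw [dotProduct_mulVec, ← mulVec_transpose, hT, dotProduct_comm]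

theorem hasDerivAt_quadratic_line {K : Matrix (Fin m) (Fin m) ℝ} (hK : K.IsHermitian)
    (c b : Fin m → ℝ) :
    HasDerivAt (fun t : ℝ => 1 / 2 * ((c + t • b) ⬝ᵥ K *ᵥ (c + t • b))) (b ⬝ᵥ K *ᵥ c) 0 := by
  have h : (fun t : ℝ => 1 / 2 * ((c + t • b) ⬝ᵥ K *ᵥ (c + t • b))) = fun t =>
      1 / 2 * (c ⬝ᵥ K *ᵥ c) + t * (b ⬝ᵥ K *ᵥ c) + t ^ 2 * (1 / 2 * (b ⬝ᵥ K *ᵥ b)) := by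
    funext t
    simp only [mulVec_add, mulVec_smul, add_dotProduct, dotProduct_add, smul_dotProduct,
      dotProduct_smul, smul_eq_mul, dotProduct_mulVec_comm_of_isHermitian hK c b]
    ring
  rw [h]
  have h1 := (((hasDerivAt_id' (0 : ℝ)).mul_const (b ⬝ᵥ K *ᵥ c)).const_add
    (1 / 2 * (c ⬝ᵥ K *ᵥ c))).fun_add
      (((hasDerivAt_id' (0 : ℝ)).fun_pow 2).mul_const (1 / 2 * (b ⬝ᵥ K *ᵥ b)))
  exact h1.congr_deriv (by simp)

theorem contDiffOn_closedLoopEnergy {X : Set (Fin n → ℝ)} {f : (Fin n → ℝ) → Fin n → ℝ}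
    {g : (Fin n → ℝ) → Matrix (Fin n) (Fin m) ℝ} {S : (Fin n → ℝ) → ℝ}
    (hS : ContDiffOn ℝ 2 S X) {γ : (Fin n → ℝ) → Fin m → ℝ} (hγ : ContDiffOn ℝ 2 γ X)
    (α β : Fin m → ℝ) (xs : Fin n → ℝ) (Kc : Matrix (Fin m) (Fin m) ℝ) :
    ContDiffOn ℝ 2 (closedLoopEnergy f g S γ α β xs Kc) (X ×ˢ univ) := by
  have hfst : ContDiffOn ℝ 2 (Prod.fst : (Fin n → ℝ) × (Fin m → ℝ) → Fin n → ℝ) (X ×ˢ univ) :=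
    contDiff_fst.contDiffOn
  have hmaps : MapsTo (Prod.fst : (Fin n → ℝ) × (Fin m → ℝ) → Fin n → ℝ) (X ×ˢ univ) X :=
    fun p hp => hp.1
  have hγ' : ∀ i, ContDiffOn ℝ 2 (fun p : (Fin n → ℝ) × (Fin m → ℝ) => γ p.1 i) (X ×ˢ univ) :=
    fun i => (contDiffOn_pi.1 hγ i).comp hfst hmaps
  have hsnd : ∀ i, ContDiffOn ℝ 2 (fun p : (Fin n → ℝ) × (Fin m → ℝ) => p.2 i) (X ×ˢ univ) :=
    fun i => by fun_prop
  have hlogcosh : ContDiff ℝ 2 fun x => Real.log (Real.cosh x) :=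
    Real.contDiff_cosh.log fun x => (Real.cosh_pos x).ne'
  refine (((hS.comp hfst hmaps).add ?_).add ?_).add ?_
  · refine ContDiffOn.sum fun i _ => contDiffOn_const.mul (hlogcosh.comp_contDiffOn ?_)
    exact contDiffOn_const.mul (((hγ' i).sub contDiffOn_const).add (hsnd i))
  · exact ContDiffOn.sum fun i _ => contDiffOn_const.mul (hγ' i)
  · exact contDiffOn_const.mul
      ((contDiff_dotProduct_mulVec Kc).comp contDiff_snd).contDiffOn

theorem fderiv_closedLoopEnergy_apply {X : Set (Fin n → ℝ)} (hX : IsOpen X)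
    {f : (Fin n → ℝ) → Fin n → ℝ} {g : (Fin n → ℝ) → Matrix (Fin n) (Fin m) ℝ}
    {S : (Fin n → ℝ) → ℝ} (hS : ContDiffOn ℝ 2 S X) {γ : (Fin n → ℝ) → Fin m → ℝ}
    (hγ : ContDiffOn ℝ 2 γ X) (α : Fin m → ℝ) {β : Fin m → ℝ} (hβ : ∀ i, 0 < β i)
    (xs : Fin n → ℝ) {Kc : Matrix (Fin m) (Fin m) ℝ} (hKc : Kc.IsHermitian)
    {p : (Fin n → ℝ) × (Fin m → ℝ)} (hp : p.1 ∈ X) (h : (Fin n → ℝ) × (Fin m → ℝ)) :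
    fderiv ℝ (closedLoopEnergy f g S γ α β xs Kc) p h =
      fderiv ℝ S p.1 h.1
        + ∑ i, satTanh α β (zc (γ xs) (γ p.1) p.2) i * (fderiv ℝ (fun x => γ x i) p.1 h.1 + h.2 i)
        + fderiv ℝ (fun x => γ x ⬝ᵥ kappa f g xs) p.1 h.1 + h.2 ⬝ᵥ Kc *ᵥ p.2 := by
  have hpM : (X ×ˢ (univ : Set (Fin m → ℝ))) ∈ 𝓝 p :=
    (hX.prod isOpen_univ).mem_nhds ⟨hp, mem_univ _⟩
  have hVd : DifferentiableAt ℝ (closedLoopEnergy f g S γ α β xs Kc) p :=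
    ((contDiffOn_closedLoopEnergy hS hγ α β xs Kc).contDiffAt hpM).differentiableAt two_ne_zero
  have hXp := hX.mem_nhds hp
  have hSd : DifferentiableAt ℝ S p.1 := (hS.contDiffAt hXp).differentiableAt two_ne_zero
  have hγd : ∀ i, DifferentiableAt ℝ (fun x => γ x i) p.1 := fun i =>
    ((contDiffOn_pi.1 hγ i).contDiffAt hXp).differentiableAt two_ne_zero
  have hγκd : DifferentiableAt ℝ (fun x => γ x ⬝ᵥ kappa f g xs) p.1 := by
    simp only [dotProduct]
    exact DifferentiableAt.fun_sum fun i _ => (hγd i).mul_const _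
  refine (hasDerivAt_comp_line hVd h).unique ?_
  have hΦ : ∀ i, HasDerivAt (fun t : ℝ => α i / β i *
      Real.log (Real.cosh (β i * zc (γ xs) (γ (p.1 + t • h.1)) (p.2 + t • h.2) i)))
      (satTanh α β (zc (γ xs) (γ p.1) p.2) i * (fderiv ℝ (fun x => γ x i) p.1 h.1 + h.2 i)) 0 := by
    intro i
    have h1 : HasDerivAt (fun t : ℝ => β i * (γ (p.1 + t • h.1) i - γ xs i + (p.2 i + t * h.2 i)))
        (β i * (fderiv ℝ (fun x => γ x i) p.1 h.1 + h.2 i)) 0 :=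
      (((hasDerivAt_comp_line (hγd i) h.1).sub_const (γ xs i)).add
        (by simpa using hasDerivAt_add_smul (p.2 i) (h.2 i))).const_mul (β i)
    have h2 := ((hasDerivAt_log_cosh _).comp (0 : ℝ) h1).const_mul (α i / β i)
    convert! h2 using 1
    have := (hβ i).ne'
    simp only [satTanh, zc, Pi.add_apply, Pi.sub_apply, zero_smul, zero_mul, add_zero]
    field_simp
  have hcomm : ∀ x, kappa f g xs ⬝ᵥ γ x = γ x ⬝ᵥ kappa f g xs := fun x => dotProduct_comm _ _
  simp only [closedLoopEnergy, hcomm]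
  exact (((hasDerivAt_comp_line hSd h.1).add (HasDerivAt.fun_sum fun i _ => hΦ i)).add
    (hasDerivAt_comp_line hγκd h.1)).add (hasDerivAt_quadratic_line hKc p.2 h.2)

/-- The second derivative is the derivative at `t = 0` of the first derivative along the line
`q + t h`; the terms with a second derivative of `γ` and a factor `tanh` vanish there. -/
theorem fderiv_fderiv_closedLoopEnergy_apply {X : Set (Fin n → ℝ)} (hX : IsOpen X)
    {f : (Fin n → ℝ) → Fin n → ℝ} {g : (Fin n → ℝ) → Matrix (Fin n) (Fin m) ℝ}
    {S : (Fin n → ℝ) → ℝ} (hS : ContDiffOn ℝ 2 S X) {γ : (Fin n → ℝ) → Fin m → ℝ}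
    (hγ : ContDiffOn ℝ 2 γ X) (α : Fin m → ℝ) {β : Fin m → ℝ} (hβ : ∀ i, 0 < β i)
    {xs : Fin n → ℝ} (hxs : xs ∈ X) {Kc : Matrix (Fin m) (Fin m) ℝ} (hKc : Kc.IsHermitian)
    (h : (Fin n → ℝ) × (Fin m → ℝ)) :
    fderiv ℝ (fderiv ℝ (closedLoopEnergy f g S γ α β xs Kc)) (xs, 0) h h =
      h.1 ⬝ᵥ hess S xs *ᵥ h.1
        + ∑ i, α i * β i * (fderiv ℝ (fun x => γ x i) xs h.1 + h.2 i) ^ 2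
        + h.1 ⬝ᵥ hess (fun x => γ x ⬝ᵥ kappa f g xs) xs *ᵥ h.1 + h.2 ⬝ᵥ Kc *ᵥ h.2 := by
  have hqM : (X ×ˢ (univ : Set (Fin m → ℝ))) ∈ 𝓝 (xs, (0 : Fin m → ℝ)) :=
    (hX.prod isOpen_univ).mem_nhds ⟨hxs, mem_univ _⟩
  have hXs := hX.mem_nhds hxs
  have hVd := differentiableAt_fderiv
    ((contDiffOn_closedLoopEnergy (f := f) (g := g) hS hγ α β xs Kc).contDiffAt hqM)
  have hSd := differentiableAt_fderiv (hS.contDiffAt hXs)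
  have hγC : ∀ i, ContDiffAt ℝ 2 (fun x => γ x i) xs := fun i =>
    (contDiffOn_pi.1 hγ i).contDiffAt hXs
  have hγκC : ContDiffAt ℝ 2 (fun x => γ x ⬝ᵥ kappa f g xs) xs := by
    simp only [dotProduct]
    exact ContDiffAt.sum fun i _ => (hγC i).mul contDiffAt_const
  rw [← fderiv_fderiv_apply_eq_hess hSd,
    ← fderiv_fderiv_apply_eq_hess (differentiableAt_fderiv hγκC)]
  refine (hasDerivAt_fderiv_line hVd h).unique ?_
  have hnear : ∀ᶠ t : ℝ in 𝓝 0, xs + t • h.1 ∈ X := by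
    have hcont : ContinuousAt (fun t : ℝ => xs + t • h.1) 0 := by fun_prop
    exact hcont.eventually_mem (by simpa using hXs)
  have hsum : ∀ i, HasDerivAt (fun t : ℝ =>
      satTanh α β (zc (γ xs) (γ (xs + t • h.1)) (0 + t • h.2)) i
        * (fderiv ℝ (fun x => γ x i) (xs + t • h.1) h.1 + h.2 i))
      (α i * β i * (fderiv ℝ (fun x => γ x i) xs h.1 + h.2 i) ^ 2) 0 := by
    intro i
    have h1 : HasDerivAt (fun t : ℝ => β i * (γ (xs + t • h.1) i - γ xs i + (0 + t * h.2 i)))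
        (β i * (fderiv ℝ (fun x => γ x i) xs h.1 + h.2 i)) 0 :=
      (((hasDerivAt_comp_line ((hγC i).differentiableAt two_ne_zero) h.1).sub_const (γ xs i)).add
        (by simpa using hasDerivAt_add_smul (0 : ℝ) (h.2 i))).const_mul (β i)
    have h2 : HasDerivAt Real.tanh 1
        (β i * (γ (xs + (0 : ℝ) • h.1) i - γ xs i + (0 + 0 * h.2 i))) := by
      simpa using hasDerivAt_tanh_zero
    have h3 := ((h2.comp (0 : ℝ) h1).const_mul (α i)).mul
      ((hasDerivAt_fderiv_line (differentiableAt_fderiv (hγC i)) h.1).add_const (h.2 i))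
    convert! h3 using 1
    simp
    ring
  have hquad : HasDerivAt (fun t : ℝ => h.2 ⬝ᵥ Kc *ᵥ (0 + t • h.2)) (h.2 ⬝ᵥ Kc *ᵥ h.2) 0 := by
    have := (hasDerivAt_id (0 : ℝ)).mul_const (h.2 ⬝ᵥ Kc *ᵥ h.2)
    simpa [mulVec_smul, dotProduct_smul] using this
  refine ((((hasDerivAt_fderiv_line hSd h.1).add (HasDerivAt.fun_sum fun i _ => hsum i)).add
    (hasDerivAt_fderiv_line (differentiableAt_fderiv hγκC) h.1)).add hquad).congr_of_eventuallyEq ?_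
  filter_upwards [hnear] with t ht
  exact fderiv_closedLoopEnergy_apply hX hS hγ α hβ xs hKc
    (p := (xs, (0 : Fin m → ℝ)) + t • h) ht h

end ClosedLoop

/-! ### Local Lipschitz continuity of the closed loop -/

section LipschitzNear

variable {E F : Type*} [PseudoMetricSpace E] [PseudoMetricSpace F]

theorem exists_lipschitzOnWith_pi {ι : Type*} [Fintype ι] {G : ι → Type*}
    [∀ i, PseudoMetricSpace (G i)] {f : E → ∀ i, G i} {x : E}
    (h : ∀ i, ∃ K, ∃ s ∈ 𝓝 x, LipschitzOnWith K (fun y => f y i) s) :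
    ∃ K, ∃ s ∈ 𝓝 x, LipschitzOnWith K f s := by
  choose K s hs hK using h
  refine ⟨Finset.univ.sup K, ⋂ i, s i, iInter_mem.2 hs, fun y hy z hz => ?_⟩
  rw [edist_pi_le_iff]
  intro i
  refine (hK i (mem_iInter.1 hy i) (mem_iInter.1 hz i)).trans ?_
  gcongr
  exact Finset.le_sup (Finset.mem_univ i)

theorem exists_lipschitzOnWith_comp {G : Type*} [PseudoMetricSpace G] {f : E → F} {g : F → G}
    {x : E} (hg : ∃ K, ∃ s ∈ 𝓝 (f x), LipschitzOnWith K g s)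
    (hf : ∃ K, ∃ s ∈ 𝓝 x, LipschitzOnWith K f s) :
    ∃ K, ∃ s ∈ 𝓝 x, LipschitzOnWith K (fun y => g (f y)) s := by
  obtain ⟨Kg, t, ht, hKg⟩ := hg
  obtain ⟨Kf, s, hs, hKf⟩ := hf
  have hcont : ContinuousAt f x := hKf.continuousOn.continuousAt hs
  exact ⟨Kg * Kf, s ∩ f ⁻¹' t, inter_mem hs (hcont ht),
    hKg.comp (hKf.mono inter_subset_left) fun y hy => hy.2⟩

theorem LocallyLipschitzOn.exists_lipschitzOnWith_comp_fst {f : E → F} {X : Set E}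
    (hf : LocallyLipschitzOn X f) (hX : IsOpen X) {G : Type*} [PseudoMetricSpace G] {p : E × G}
    (hp : p.1 ∈ X) : ∃ K, ∃ s ∈ 𝓝 p, LipschitzOnWith K (fun y : E × G => f y.1) s := by
  refine exists_lipschitzOnWith_comp (g := f) (f := Prod.fst) ?_
    ⟨1, univ, univ_mem, LipschitzWith.prod_fst.lipschitzOnWith⟩
  obtain ⟨K, s, hs, hK⟩ := hf hp
  rw [hX.nhdsWithin_eq hp] at hs
  exact ⟨K, s, hs, hK⟩

end LipschitzNear

section ClosedLoop

variable {n m r : ℕ}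

/-- The closed-loop field is a `C¹` function of the state and of the values `f(x)` and `g(x)`, which
depend on the state in a Lipschitz way. -/
theorem exists_lipschitzOnWith_closedLoop {X : Set (Fin n → ℝ)} (hX : IsOpen X)
    {f : (Fin n → ℝ) → Fin n → ℝ} (hf : LocallyLipschitzOn X f)
    {g : (Fin n → ℝ) → Matrix (Fin n) (Fin m) ℝ}
    (hg : ∀ i j, LocallyLipschitzOn X (fun x => g x i j))
    {γ : (Fin n → ℝ) → Fin m → ℝ} (hγ : ContDiffOn ℝ 2 γ X) (α β : Fin m → ℝ)
    (xs : Fin n → ℝ) (Rc Kc : Matrix (Fin m) (Fin m) ℝ)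
    {p : (Fin n → ℝ) × (Fin m → ℝ)} (hp : p.1 ∈ X) :
    ∃ K, ∃ s ∈ 𝓝 p, LipschitzOnWith K (closedLoop f g γ α β xs Rc Kc) s := by
  have hγp : ContDiffAt ℝ 1 γ p.1 := (hγ.contDiffAt (hX.mem_nhds hp)).of_le (by norm_num)
  have hT : ∀ i, ContDiffAt ℝ 1
      (fun p : (Fin n → ℝ) × (Fin m → ℝ) => satTanh α β (zc (γ xs) (γ p.1) p.2) i) p := by
    intro i
    have h1 : ContDiffAt ℝ 1 (fun p : (Fin n → ℝ) × (Fin m → ℝ) => γ p.1 i) p :=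
      ContDiffAt.comp (g := fun x => γ x i) p (contDiffAt_pi.1 hγp i) contDiffAt_fst
    have h2 : ContDiffAt ℝ 1 (fun p : (Fin n → ℝ) × (Fin m → ℝ) => p.2 i) p := by fun_prop
    exact contDiffAt_const.mul (contDiff_tanh.contDiffAt.comp p
      (contDiffAt_const.mul ((h1.sub contDiffAt_const).add h2)))
  let Ψ : ((Fin n → ℝ) × (Fin n → Fin m → ℝ)) × ((Fin n → ℝ) × (Fin m → ℝ)) →
      (Fin n → ℝ) × (Fin m → ℝ) := fun d =>
    (fun i => d.1.1 i + ∑ j, d.1.2 i j * closedLoopInput f g γ α β xs d.2 j,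
      fun i => -∑ j, Rc i j * (satTanh α β (zc (γ xs) (γ d.2.1) d.2.2) j
        + ∑ k, Kc j k * d.2.2 k))
  let η : (Fin n → ℝ) × (Fin m → ℝ) →
      ((Fin n → ℝ) × (Fin n → Fin m → ℝ)) × ((Fin n → ℝ) × (Fin m → ℝ)) := fun p =>
    ((f p.1, fun i j => g p.1 i j), p)
  have hΨη : closedLoop f g γ α β xs Rc Kc = fun p => Ψ (η p) := rfl
  rw [hΨη]
  refine exists_lipschitzOnWith_comp ?_ ?_
  · refine ContDiffAt.exists_lipschitzOnWith (𝕂 := ℝ) ?_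
    have hT' : ∀ i, ContDiffAt ℝ 1
        (fun d : ((Fin n → ℝ) × (Fin n → Fin m → ℝ)) × ((Fin n → ℝ) × (Fin m → ℝ)) =>
          satTanh α β (zc (γ xs) (γ d.2.1) d.2.2) i) (η p) := fun i =>
      ContDiffAt.comp (g := fun p : (Fin n → ℝ) × (Fin m → ℝ) =>
        satTanh α β (zc (γ xs) (γ p.1) p.2) i) (η p) (hT i) contDiffAt_snd
    have hu : ∀ i, ContDiffAt ℝ 1
        (fun d : ((Fin n → ℝ) × (Fin n → Fin m → ℝ)) × ((Fin n → ℝ) × (Fin m → ℝ)) =>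
          closedLoopInput f g γ α β xs d.2 i) (η p) := fun i =>
      contDiffAt_const.sub (hT' i)
    refine ContDiffAt.prodMk (contDiffAt_pi.2 fun i => ?_) (contDiffAt_pi.2 fun i => ?_)
    · refine ContDiffAt.add (by fun_prop) (ContDiffAt.sum fun j _ => ContDiffAt.mul ?_ (hu j))
      fun_prop
    · refine (ContDiffAt.sum fun j _ => contDiffAt_const.mul ((hT' j).add ?_)).neg
      fun_prop
  · have hfp := hf.exists_lipschitzOnWith_comp_fst hX hp
    have hgp : ∃ K, ∃ s ∈ 𝓝 p, LipschitzOnWith K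
        (fun p : (Fin n → ℝ) × (Fin m → ℝ) => fun i j => g p.1 i j) s :=
      exists_lipschitzOnWith_pi fun i => exists_lipschitzOnWith_pi fun j =>
        (hg i j).exists_lipschitzOnWith_comp_fst hX hp
    obtain ⟨K₁, s₁, hs₁, hK₁⟩ := hfp
    obtain ⟨K₂, s₂, hs₂, hK₂⟩ := hgp
    exact ⟨_, s₁ ∩ s₂, inter_mem hs₁ hs₂, ((hK₁.mono inter_subset_left).prodMk
      (hK₂.mono inter_subset_right)).prodMk LipschitzWith.id.lipschitzOnWith⟩

/-! ### Dissipation and the strict minimum of the energy -/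

theorem fderiv_dotProduct_const {γ : (Fin n → ℝ) → Fin m → ℝ} {x : Fin n → ℝ}
    (hγ : DifferentiableAt ℝ γ x) (κ : Fin m → ℝ) (a : Fin n → ℝ) :
    fderiv ℝ (fun x => γ x ⬝ᵥ κ) x a = ((jac γ x)ᵀ *ᵥ a) ⬝ᵥ κ := by
  have h1 : HasFDerivAt (fun x => ∑ i, γ x i * κ i)
      (∑ i, κ i • fderiv ℝ (fun x => γ x i) x) x :=
    HasFDerivAt.fun_sum fun i _ => (differentiableAt_pi.1 hγ i).hasFDerivAt.mul_const (κ i)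
  have h2 : fderiv ℝ (fun x => γ x ⬝ᵥ κ) x = ∑ i, κ i • fderiv ℝ (fun x => γ x i) x := h1.fderiv
  rw [h2]
  simp only [_root_.sum_apply, _root_.smul_apply, smul_eq_mul, dotProduct,
    transpose_jac_mulVec_apply]
  exact Finset.sum_congr rfl fun i _ => mul_comm _ _

/-- The closed-loop energy is dissipated at the rate `‖ℓ + w u‖² + vᵀ R_c v`, where `v` is the
vector `∑ᵢ eᵢ αᵢ tanh(βᵢ z_cᵢ) + K_c x_c`. -/
theorem fderiv_closedLoopEnergy_closedLoop {X : Set (Fin n → ℝ)} (hX : IsOpen X)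
    {f : (Fin n → ℝ) → Fin n → ℝ} {g : (Fin n → ℝ) → Matrix (Fin n) (Fin m) ℝ}
    {S : (Fin n → ℝ) → ℝ} (hS : ContDiffOn ℝ 2 S X)
    {ℓ : (Fin n → ℝ) → Fin r → ℝ} (hSf : StorageCondition X f S ℓ)
    {w : (Fin n → ℝ) → Matrix (Fin r) (Fin m) ℝ}
    {D : (Fin n → ℝ) → Matrix (Fin m) (Fin m) ℝ} (hD : ∀ x ∈ X, D x = -(D x)ᵀ)
    {xs : Fin n → ℝ} {γ : (Fin n → ℝ) → Fin m → ℝ} (hγ : ContDiffOn ℝ 2 γ X) {α β : Fin m → ℝ}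
    (hshape : ShapingCondition X f g S ℓ w D γ α β xs)
    (Rc : Matrix (Fin m) (Fin m) ℝ) {Kc : Matrix (Fin m) (Fin m) ℝ} (hKc : Kc.IsHermitian)
    {p : (Fin n → ℝ) × (Fin m → ℝ)} (hp : p.1 ∈ X) :
    fderiv ℝ (closedLoopEnergy f g S γ α β xs Kc) p (closedLoop f g γ α β xs Rc Kc p) =
      -((ℓ p.1 + w p.1 *ᵥ closedLoopInput f g γ α β xs p)
          ⬝ᵥ (ℓ p.1 + w p.1 *ᵥ closedLoopInput f g γ α β xs p))
        - (satTanh α β (zc (γ xs) (γ p.1) p.2) + Kc *ᵥ p.2)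
          ⬝ᵥ Rc *ᵥ (satTanh α β (zc (γ xs) (γ p.1) p.2) + Kc *ᵥ p.2) := by
  have hγd : DifferentiableAt ℝ γ p.1 :=
    (hγ.contDiffAt (hX.mem_nhds hp)).differentiableAt two_ne_zero
  rw [fderiv_closedLoopEnergy_apply hX hS hγ α hshape.beta_pos xs hKc hp,
    fderiv_dotProduct_const hγd, fderiv_apply_eq_grad_dotProduct]
  simp only [closedLoop, ← transpose_jac_mulVec_apply, hshape.output_eq p.1 hp]
  rw [hSf.power_balance (w := w) (D := D) hp (hD _ hp)]
  set y := passiveOutput g S ℓ w D p.1 (closedLoopInput f g γ α β xs p)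
  set T := satTanh α β (zc (γ xs) (γ p.1) p.2) with hT
  have hu : closedLoopInput f g γ α β xs p = -kappa f g xs - T := rfl
  have hxc : controllerField Rc Kc α β (γ xs) (γ p.1) p.2 = -(Rc *ᵥ (T + Kc *ᵥ p.2)) := rfl
  have hsum : ∑ i, T i * (y i + controllerField Rc Kc α β (γ xs) (γ p.1) p.2 i)
      = T ⬝ᵥ (y + controllerField Rc Kc α β (γ xs) (γ p.1) p.2) := rfl
  have hyu : y ⬝ᵥ closedLoopInput f g γ α β xs p = -(y ⬝ᵥ kappa f g xs) - T ⬝ᵥ y := by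
    rw [hu, dotProduct_sub, dotProduct_neg, dotProduct_comm y T]
  have hv : (T + Kc *ᵥ p.2) ⬝ᵥ Rc *ᵥ (T + Kc *ᵥ p.2)
      = T ⬝ᵥ Rc *ᵥ (T + Kc *ᵥ p.2) + (Rc *ᵥ (T + Kc *ᵥ p.2)) ⬝ᵥ Kc *ᵥ p.2 := by
    rw [add_dotProduct, dotProduct_comm (Kc *ᵥ p.2)]
  rw [hsum, hyu, hv, hxc, dotProduct_add T, dotProduct_neg, neg_dotProduct]
  ring

theorem fderiv_closedLoopEnergy_eq_zero {X : Set (Fin n → ℝ)} (hX : IsOpen X)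
    {f : (Fin n → ℝ) → Fin n → ℝ} {g : (Fin n → ℝ) → Matrix (Fin n) (Fin m) ℝ}
    {S : (Fin n → ℝ) → ℝ} (hS : ContDiffOn ℝ 2 S X) {γ : (Fin n → ℝ) → Fin m → ℝ}
    (hγ : ContDiffOn ℝ 2 γ X) (α : Fin m → ℝ) {β : Fin m → ℝ} (hβ : ∀ i, 0 < β i)
    {xs : Fin n → ℝ} (hxs : xs ∈ X) (hgrad : grad S xs + jac γ xs *ᵥ kappa f g xs = 0)
    {Kc : Matrix (Fin m) (Fin m) ℝ} (hKc : Kc.IsHermitian) :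
    fderiv ℝ (closedLoopEnergy f g S γ α β xs Kc) (xs, 0) = 0 := by
  have hγd : DifferentiableAt ℝ γ xs :=
    (hγ.contDiffAt (hX.mem_nhds hxs)).differentiableAt two_ne_zero
  refine ContinuousLinearMap.ext fun h => ?_
  rw [fderiv_closedLoopEnergy_apply hX hS hγ α hβ xs hKc hxs, fderiv_dotProduct_const hγd,
    fderiv_apply_eq_grad_dotProduct, transpose_mulVec_dotProduct, dotProduct_comm h.1]
  have h0 := congrArg (· ⬝ᵥ h.1) hgrad
  simp only [add_dotProduct, zero_dotProduct] at h0
  simpa [satTanh, zc] using h0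

/-- A multiple `k` of the identity above which the controller gain makes the second derivative of
the closed-loop energy positive definite. -/
theorem ShapingCondition.exists_gain {X : Set (Fin n → ℝ)} {f : (Fin n → ℝ) → Fin n → ℝ}
    {g : (Fin n → ℝ) → Matrix (Fin n) (Fin m) ℝ} {S : (Fin n → ℝ) → ℝ}
    {ℓ : (Fin n → ℝ) → Fin r → ℝ} {w : (Fin n → ℝ) → Matrix (Fin r) (Fin m) ℝ}
    {D : (Fin n → ℝ) → Matrix (Fin m) (Fin m) ℝ} {xs : Fin n → ℝ} {γ : (Fin n → ℝ) → Fin m → ℝ}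
    {α β : Fin m → ℝ} (hshape : ShapingCondition X f g S ℓ w D γ α β xs) :
    ∃ k > 0, ∀ h : (Fin n → ℝ) × (Fin m → ℝ), h ≠ 0 →
      0 < h.1 ⬝ᵥ hess S xs *ᵥ h.1
        + ∑ i, α i * β i * (fderiv ℝ (fun x => γ x i) xs h.1 + h.2 i) ^ 2
        + h.1 ⬝ᵥ hess (fun x => γ x ⬝ᵥ kappa f g xs) xs *ᵥ h.1 + k * (h.2 ⬝ᵥ h.2) := by
  set P : Matrix (Fin n) (Fin n) ℝ := hess S xs
      + ∑ i, (α i * β i) • vecMulVec (grad (fun x => γ x i) xs) (grad (fun x => γ x i) xs)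
      + hess (fun x => γ x ⬝ᵥ kappa f g xs) xs with hP
  have hPQ : ∀ a, a ⬝ᵥ P *ᵥ a = a ⬝ᵥ hess S xs *ᵥ a
      + ∑ i, α i * β i * fderiv ℝ (fun x => γ x i) xs a ^ 2
      + a ⬝ᵥ hess (fun x => γ x ⬝ᵥ kappa f g xs) xs *ᵥ a := by
    intro a
    rw [hP, add_mulVec, add_mulVec, dotProduct_add, dotProduct_add, sum_mulVec, dotProduct_sum]
    congr 2
    refine Finset.sum_congr rfl fun i _ => ?_
    rw [smul_mulVec, dotProduct_smul, vecMulVec_mulVec, fderiv_apply_eq_grad_dotProduct,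
      dotProduct_smul, MulOpposite.smul_eq_mul_unop, MulOpposite.unop_op, smul_eq_mul,
      dotProduct_comm a, sq]
  obtain ⟨k, hk, hkpos⟩ := exists_pos_forall_quadratic_pos (Q := fun a => a ⬝ᵥ P *ᵥ a)
    (contDiff_dotProduct_mulVec (k := 0) P).continuous
    (fun t h => by simp [mulVec_smul]; ring)
    (fun h hh => by simpa using hshape.hess_posDef.dotProduct_mulVec_pos hh)
    (fun i => α i * β i) (fun i => mul_pos (hshape.alpha_pos i) (hshape.beta_pos i))
    (fun i => fderiv ℝ (fun x => γ x i) xs)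
  refine ⟨k, hk, fun h hh => ?_⟩
  have hne : h.1 ≠ 0 ∨ h.2 ≠ 0 := by
    by_contra! hcon
    exact hh (Prod.ext hcon.1 hcon.2)
  have hpos := hkpos h.1 h.2 hne
  rw [hPQ] at hpos
  have hsq : ∑ i, α i * β i * (fderiv ℝ (fun x => γ x i) xs h.1 + h.2 i) ^ 2
      = ∑ i, α i * β i * fderiv ℝ (fun x => γ x i) xs h.1 ^ 2
        + ∑ i, α i * β i * (2 * fderiv ℝ (fun x => γ x i) xs h.1 * h.2 i + h.2 i ^ 2) := by
    rw [← Finset.sum_add_distrib]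
    exact Finset.sum_congr rfl fun i _ => by ring
  rw [hsq]
  linarith

theorem isLyapunovFunction_closedLoopEnergy {X : Set (Fin n → ℝ)} (hX : IsOpen X)
    {f : (Fin n → ℝ) → Fin n → ℝ} {g : (Fin n → ℝ) → Matrix (Fin n) (Fin m) ℝ}
    {S : (Fin n → ℝ) → ℝ} (hS : ContDiffOn ℝ 2 S X)
    {ℓ : (Fin n → ℝ) → Fin r → ℝ} (hSf : StorageCondition X f S ℓ)
    {w : (Fin n → ℝ) → Matrix (Fin r) (Fin m) ℝ}
    {D : (Fin n → ℝ) → Matrix (Fin m) (Fin m) ℝ} (hD : ∀ x ∈ X, D x = -(D x)ᵀ)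
    {xs : Fin n → ℝ} (hxs : xs ∈ X) {γ : (Fin n → ℝ) → Fin m → ℝ} (hγ : ContDiffOn ℝ 2 γ X)
    {α β : Fin m → ℝ} (hshape : ShapingCondition X f g S ℓ w D γ α β xs)
    {Rc Kc : Matrix (Fin m) (Fin m) ℝ} (hRc : Rc.PosDef) (hKc : Kc.IsHermitian)
    (hpos : ∀ h : (Fin n → ℝ) × (Fin m → ℝ), h ≠ 0 →
      0 < h.1 ⬝ᵥ hess S xs *ᵥ h.1
        + ∑ i, α i * β i * (fderiv ℝ (fun x => γ x i) xs h.1 + h.2 i) ^ 2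
        + h.1 ⬝ᵥ hess (fun x => γ x ⬝ᵥ kappa f g xs) xs *ᵥ h.1 + h.2 ⬝ᵥ Kc *ᵥ h.2) :
    IsLyapunovFunction (closedLoopEnergy f g S γ α β xs Kc) (closedLoop f g γ α β xs Rc Kc)
      (X ×ˢ univ) (xs, 0) := by
  have hM : IsOpen (X ×ˢ (univ : Set (Fin m → ℝ))) := hX.prod isOpen_univ
  have hq : (xs, (0 : Fin m → ℝ)) ∈ X ×ˢ univ := ⟨hxs, mem_univ _⟩
  have hVC := contDiffOn_closedLoopEnergy (f := f) (g := g) hS hγ α β xs Kc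
  have hstrict := eventually_lt_of_fderiv_fderiv_pos
    ((hM.eventually_mem hq).mono fun x hx =>
      (hVC.contDiffAt (hM.mem_nhds hx)).differentiableAt two_ne_zero)
    (fderiv_closedLoopEnergy_eq_zero hX hS hγ α hshape.beta_pos hxs hshape.grad_eq hKc)
    (differentiableAt_fderiv (hVC.contDiffAt (hM.mem_nhds hq))).hasFDerivAt
    (fun h hh => by
      rw [fderiv_fderiv_closedLoopEnergy_apply hX hS hγ α hshape.beta_pos hxs hKc]
      exact hpos h hh)
  obtain ⟨U, hUsub, hU, hqU⟩ := mem_nhds_iff.1 (inter_mem hstrict (hM.mem_nhds hq))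
  refine ⟨U, hU, hqU, fun p hp => (hUsub hp).2,
    (hVC.mono fun p hp => (hUsub hp).2).of_le (by norm_num), fun p hp => (hUsub hp).1,
    fun p hp => ?_⟩
  rw [fderiv_closedLoopEnergy_closedLoop hX hS hSf hD hγ hshape Rc hKc (hUsub hp).2.1]
  have h1 := dotProduct_self_star_nonneg
    (ℓ p.1 + w p.1 *ᵥ closedLoopInput f g γ α β xs p)
  have h2 := hRc.posSemidef.dotProduct_mulVec_nonneg
    (satTanh α β (zc (γ xs) (γ p.1) p.2) + Kc *ᵥ p.2)
  simp only [star_trivial] at h1 h2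
  linarith

/-! ### The closed-loop solutions without dissipation -/

theorem satTanh_injective {α β : Fin m → ℝ} (hα : ∀ i, 0 < α i) (hβ : ∀ i, 0 < β i) :
    Function.Injective (satTanh α β) := by
  intro z z' h
  ext i
  have h1 : α i * Real.tanh (β i * z i) = α i * Real.tanh (β i * z' i) := congrFun h i
  exact mul_left_cancel₀ (hβ i).ne'
    (Real.tanh_injective (mul_left_cancel₀ (hα i).ne' h1))

/-- Without dissipation `x_c` is at rest and `∑ᵢ eᵢ αᵢ tanh(βᵢ z_cᵢ) = -K_c x_c`, so `z_c` is
constant; then `γ` is constant along the solution, and `y`, its time derivative, vanishes. -/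
theorem detectEquations_of_fderiv_closedLoopEnergy_eq_zero {X : Set (Fin n → ℝ)} (hX : IsOpen X)
    {f : (Fin n → ℝ) → Fin n → ℝ} {g : (Fin n → ℝ) → Matrix (Fin n) (Fin m) ℝ}
    {S : (Fin n → ℝ) → ℝ} (hS : ContDiffOn ℝ 2 S X)
    {ℓ : (Fin n → ℝ) → Fin r → ℝ} (hSf : StorageCondition X f S ℓ)
    {w : (Fin n → ℝ) → Matrix (Fin r) (Fin m) ℝ}
    {D : (Fin n → ℝ) → Matrix (Fin m) (Fin m) ℝ} (hD : ∀ x ∈ X, D x = -(D x)ᵀ)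
    {xs : Fin n → ℝ} {γ : (Fin n → ℝ) → Fin m → ℝ} (hγ : ContDiffOn ℝ 2 γ X) {α β : Fin m → ℝ}
    (hshape : ShapingCondition X f g S ℓ w D γ α β xs)
    {Rc Kc : Matrix (Fin m) (Fin m) ℝ} (hRc : Rc.PosDef) (hKc : Kc.IsHermitian)
    {p : ℝ → (Fin n → ℝ) × (Fin m → ℝ)}
    (hp : IsSolutionOn (closedLoop f g γ α β xs Rc Kc) (X ×ˢ univ) (Ici 0) p)
    (hdiss : ∀ t ∈ Ici (0 : ℝ), fderiv ℝ (closedLoopEnergy f g S γ α β xs Kc) (p t)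
      (closedLoop f g γ α β xs Rc Kc (p t)) = 0) :
    ∀ t ∈ Ici (0 : ℝ), DetectEquations f g S ℓ w D γ α β xs Kc (p t) := by
  set T : ℝ → Fin m → ℝ := fun t => satTanh α β (zc (γ xs) (γ (p t).1) (p t).2)
  have hzero : ∀ t ∈ Ici (0 : ℝ),
      ℓ (p t).1 + w (p t).1 *ᵥ closedLoopInput f g γ α β xs (p t) = 0 ∧
        T t + Kc *ᵥ (p t).2 = 0 := by
    intro t ht
    have h := hdiss t ht
    rw [fderiv_closedLoopEnergy_closedLoop hX hS hSf hD hγ hshape Rc hKc (hp t ht).1.1] at h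
    have h1 := dotProduct_self_star_nonneg
      (ℓ (p t).1 + w (p t).1 *ᵥ closedLoopInput f g γ α β xs (p t))
    have h2 := hRc.posSemidef.dotProduct_mulVec_nonneg (T t + Kc *ᵥ (p t).2)
    simp only [star_trivial] at h1 h2
    refine ⟨dotProduct_self_eq_zero.1 (by linarith), ?_⟩
    by_contra hne
    have h3 := hRc.dotProduct_mulVec_pos hne
    simp only [star_trivial] at h3
    linarith
  have hTt : ∀ t ∈ Ici (0 : ℝ), T t = -(Kc *ᵥ (p t).2) := fun t ht =>
    eq_neg_of_add_eq_zero_left (hzero t ht).2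
  have hxc' : ∀ t ∈ Ici (0 : ℝ), HasDerivWithinAt (fun t => (p t).2) 0 (Ici 0) t := by
    intro t ht
    have h1 : HasDerivWithinAt (fun t => (p t).2) (closedLoop f g γ α β xs Rc Kc (p t)).2
        (Ici 0) t := (hp t ht).2.snd
    refine h1.congr_deriv ?_
    change -(Rc *ᵥ (T t + Kc *ᵥ (p t).2)) = 0
    rw [(hzero t ht).2, mulVec_zero, neg_zero]
  have hxc : ∀ t ∈ Ici (0 : ℝ), (p t).2 = (p 0).2 := by
    intro t ht
    have h := (convex_Ici (0 : ℝ)).norm_image_sub_le_of_norm_hasDerivWithin_le (C := 0) hxc'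
      (fun s _ => by simp) self_mem_Ici ht
    rw [zero_mul] at h
    exact sub_eq_zero.1 (norm_le_zero_iff.1 h)
  have hγc : ∀ t ∈ Ici (0 : ℝ), γ (p t).1 = γ (p 0).1 := by
    intro t ht
    have hz : zc (γ xs) (γ (p t).1) (p t).2 = zc (γ xs) (γ (p 0).1) (p 0).2 := by
      apply satTanh_injective hshape.alpha_pos hshape.beta_pos
      change T t = T 0
      rw [hTt t ht, hTt 0 self_mem_Ici, hxc t ht]
    simpa [zc, hxc t ht] using hz
  intro t ht
  constructor
  · have h1 := (hzero t ht).1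
    have hu : closedLoopInput f g γ α β xs (p t) = -(kappa f g xs - Kc *ᵥ (p t).2) := by
      change -kappa f g xs - T t = _
      rw [hTt t ht]
      abel
    rw [hu, mulVec_neg, ← sub_eq_add_neg] at h1
    exact sub_eq_zero.1 h1
  · have hXt : (p t).1 ∈ X := (hp t ht).1.1
    rw [← hshape.output_eq _ hXt]
    ext i
    rw [transpose_jac_mulVec_apply, Pi.zero_apply]
    have hγd : DifferentiableAt ℝ (fun x => γ x i) (p t).1 :=
      ((contDiffOn_pi.1 hγ i).contDiffAt (hX.mem_nhds hXt)).differentiableAt two_ne_zero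
    have hx' : HasDerivWithinAt (fun t => (p t).1) (closedLoop f g γ α β xs Rc Kc (p t)).1
        (Ici 0) t := (hp t ht).2.fst
    have h1 : HasDerivWithinAt (fun t => γ (p t).1 i)
        (fderiv ℝ (fun x => γ x i) (p t).1 (closedLoop f g γ α β xs Rc Kc (p t)).1) (Ici 0) t :=
      HasFDerivAt.comp_hasDerivWithinAt (l := fun x => γ x i) t hγd.hasFDerivAt hx'
    have h2 : HasDerivWithinAt (fun t => γ (p t).1 i) 0 (Ici 0) t :=
      (hasDerivWithinAt_const t (Ici 0) (γ (p 0).1 i)).congr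
        (fun s hs => by rw [hγc s hs]) (by rw [hγc t ht])
    exact (uniqueDiffOn_Ici (0 : ℝ) t ht).eq_deriv _ h1 h2

/-! ### Stability of the closed loop -/

theorem closedLoop_equilibrium {X : Set (Fin n → ℝ)} {f : (Fin n → ℝ) → Fin n → ℝ}
    {g : (Fin n → ℝ) → Matrix (Fin n) (Fin m) ℝ} {xs : Fin n → ℝ}
    (hxs : xs ∈ assignableEquilibria X f g) (hrank : (g xs).rank = m)
    (γ : (Fin n → ℝ) → Fin m → ℝ) (α β : Fin m → ℝ) (Rc Kc : Matrix (Fin m) (Fin m) ℝ) :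
    closedLoop f g γ α β xs Rc Kc (xs, 0) = 0 := by
  have hT : satTanh α β (zc (γ xs) (γ xs) 0) = 0 := by
    ext i
    simp [satTanh, zc]
  simp [closedLoop, closedLoopInput, controlLaw, controllerField, hT, mulVec_neg,
    mulVec_kappa_of_mem_assignableEquilibria hxs hrank]

theorem closedLoopInput_mem_Icc (f : (Fin n → ℝ) → Fin n → ℝ)
    (g : (Fin n → ℝ) → Matrix (Fin n) (Fin m) ℝ) (γ : (Fin n → ℝ) → Fin m → ℝ) {α : Fin m → ℝ}
    (hα : ∀ i, 0 < α i) (β : Fin m → ℝ) (xs : Fin n → ℝ) (p : (Fin n → ℝ) × (Fin m → ℝ))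
    (i : Fin m) : closedLoopInput f g γ α β xs p i
      ∈ Icc (-kappa f g xs i - α i) (-kappa f g xs i + α i) := by
  change -kappa f g xs i - α i * Real.tanh (β i * zc (γ xs) (γ p.1) p.2 i) ∈ _
  have h1 := Real.tanh_lt_one (β i * zc (γ xs) (γ p.1) p.2 i)
  have h2 := Real.neg_one_lt_tanh (β i * zc (γ xs) (γ p.1) p.2 i)
  constructor <;> nlinarith [hα i]

end ClosedLoop

theorem mainTheorem2 {n m r : ℕ}
    -- the plant `x' = f(x) + g(x) u` on the open state space `X`
    (X : Set (Fin n → ℝ)) (hX : IsOpen X)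
    (f : (Fin n → ℝ) → Fin n → ℝ) (hf : LocallyLipschitzOn X f)
    (g : (Fin n → ℝ) → Matrix (Fin n) (Fin m) ℝ)
    (hg : ∀ i j, LocallyLipschitzOn X (fun x => g x i j))
    (hrank : ∀ x ∈ X, (g x).rank = m)
    -- the storage function and the data of the passive output
    (S : (Fin n → ℝ) → ℝ) (hS : ContDiffOn ℝ 2 S X)
    (ℓ : (Fin n → ℝ) → Fin r → ℝ) (hSf : StorageCondition X f S ℓ)
    (w : (Fin n → ℝ) → Matrix (Fin r) (Fin m) ℝ)
    (D : (Fin n → ℝ) → Matrix (Fin m) (Fin m) ℝ) (hD : ∀ x ∈ X, D x = -(D x)ᵀ)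
    -- the desired equilibrium and the energy shaping condition
    (xs : Fin n → ℝ) (hxs : xs ∈ assignableEquilibria X f g)
    (γ : (Fin n → ℝ) → Fin m → ℝ) (hγ : ContDiffOn ℝ 2 γ X) (α β : Fin m → ℝ)
    (hshape : ShapingCondition X f g S ℓ w D γ α β xs) :
    -- (i) the control signals are saturated
    (∀ x ∈ X, ∀ (xc : Fin m → ℝ) (i : Fin m),
      closedLoopInput f g γ α β xs (x, xc) i
        ∈ Icc (-kappa f g xs i - α i) (-kappa f g xs i + α i)) ∧
    ∃ K₀ : Matrix (Fin m) (Fin m) ℝ, K₀.PosDef ∧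
      ∀ Kc : Matrix (Fin m) (Fin m) ℝ, (Kc - K₀).PosSemidef →
      ∀ Rc : Matrix (Fin m) (Fin m) ℝ, Rc.PosDef →
        -- (ii) stability, with the closed-loop energy as a Lyapunov function
        IsStableEquilibrium (closedLoop f g γ α β xs Rc Kc) (X ×ˢ univ) (xs, 0) ∧
        IsLyapunovFunction (closedLoopEnergy f g S γ α β xs Kc)
          (closedLoop f g γ α β xs Rc Kc) (X ×ˢ univ) (xs, 0) ∧
        ∀ Ω : Set ((Fin n → ℝ) × (Fin m → ℝ)), IsOpen Ω → Ω ⊆ X ×ˢ univ → (xs, 0) ∈ Ω →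
          -- (iii) asymptotic stability, if the equations single out `(x⋆, 0)` in `Ω` pointwise
          ((∀ p ∈ Ω, DetectEquations f g S ℓ w D γ α β xs Kc p → p = (xs, 0)) →
            IsAsymptoticallyStableEquilibrium (closedLoop f g γ α β xs Rc Kc)
              (X ×ˢ univ) (xs, 0)) ∧
          -- (iii) asymptotic stability, if they do so along the closed-loop solutions in `Ω`
          ((∀ p : ℝ → (Fin n → ℝ) × (Fin m → ℝ),
              IsSolutionOn (closedLoop f g γ α β xs Rc Kc) Ω (Ici 0) p →
              (∀ t ∈ Ici (0 : ℝ), DetectEquations f g S ℓ w D γ α β xs Kc (p t)) →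
              ∀ t ∈ Ici (0 : ℝ), p t = (xs, 0)) →
            IsAsymptoticallyStableEquilibrium (closedLoop f g γ α β xs Rc Kc)
              (X ×ˢ univ) (xs, 0)) := by
  have hxsX : xs ∈ X := hxs.1
  refine ⟨fun x _ xc i =>
    closedLoopInput_mem_Icc f g γ hshape.alpha_pos β xs (x, xc) i, ?_⟩
  obtain ⟨k, hk, hgain⟩ := hshape.exists_gain
  refine ⟨k • 1, PosDef.one.smul hk, fun Kc hKc Rc hRc => ?_⟩
  have hKH : Kc.IsHermitian := by
    have h := hKc.isHermitian.add
      (PosDef.one.smul hk : (k • (1 : Matrix (Fin m) (Fin m) ℝ)).PosDef).1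
    rwa [sub_add_cancel] at h
  have hKk : ∀ b : Fin m → ℝ, k * (b ⬝ᵥ b) ≤ b ⬝ᵥ Kc *ᵥ b := by
    intro b
    have h := hKc.dotProduct_mulVec_nonneg b
    simp only [star_trivial, sub_mulVec, smul_mulVec, one_mulVec, dotProduct_sub, dotProduct_smul,
      smul_eq_mul] at h
    linarith
  have hLyap := isLyapunovFunction_closedLoopEnergy hX hS hSf hD hxsX hγ hshape hRc hKH
    fun h hh => (hgain h hh).trans_le (by gcongr; exact hKk h.2)
  have hLip := exists_lipschitzOnWith_closedLoop hX hf hg hγ α β xs Rc Kc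
    (p := (xs, (0 : Fin m → ℝ))) hxsX
  have hq := closedLoop_equilibrium hxs (hrank xs hxsX) γ α β Rc Kc
  refine ⟨hLyap.isStableEquilibrium hq hLip, hLyap, fun Ω hΩ hΩX hqΩ => ?_⟩
  have hLaSalle : (∀ p : ℝ → (Fin n → ℝ) × (Fin m → ℝ),
      IsSolutionOn (closedLoop f g γ α β xs Rc Kc) Ω (Ici 0) p →
      (∀ t ∈ Ici (0 : ℝ), DetectEquations f g S ℓ w D γ α β xs Kc (p t)) →
      ∀ t ∈ Ici (0 : ℝ), p t = (xs, 0)) →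
      IsAsymptoticallyStableEquilibrium (closedLoop f g γ α β xs Rc Kc)
        (X ×ˢ univ) (xs, 0) := fun hdet =>
    hLyap.isAsymptoticallyStableEquilibrium hq hLip (hΩ.mem_nhds hqΩ) fun p hp hdiss =>
      hdet p hp (detectEquations_of_fderiv_closedLoopEnergy_eq_zero hX hS hSf hD hγ hshape hRc hKH
        (fun t ht => ⟨hΩX (hp t ht).1, (hp t ht).2⟩) hdiss) 0 self_mem_Ici
  exact ⟨fun hpt => hLaSalle fun p hp hdet t ht => hpt _ (hp t ht).1 (hdet t ht), hLaSalle⟩
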